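/- **Time warps.** Let $\omega^+=\omega\cup\{\omega\}$ with its natural order. A *time warp* is a function $\omega^+\to\omega^+$ preserving arbitrary suprema. Ordered pointwise, the time warps form a lattice with least element $\bot$ and greatest element $\top$; with composition $fg=f\circ g$, the identity $\mathrm{id}$ and the residuals determined by $f\le h/g\iff fg\le h\iff g\le f\backslash h$, they form the *time warp algebra* $\mathbf W=\langle W,\wedge,\vee,\circ,\backslash,/,\mathrm{id},\bot,\top\rangle$. An inequality $s\le t$ of terms stands for the equation $s\wedge t\approx s$. *Basic terms* are generated from countably many variables by $t,u::=x\mid tu\mid t^{o}\mid t^{\ell}\mid t^{r}\mid\mathrm{id}\mid\bot$, where $t^{o}:=\top\backslash t$, $t^{\ell}:=\mathrm{id}/t$, $t^{r}:=t\backslash\mathrm{id}$. **Samples.** *Samples* are generated by $\alpha::=\kappa\mid t[\alpha]\mid \mathsf s(\alpha)\mid\mathsf p(\alpha)\mid\mathsf{last}(t)$, with $\kappa$ a time variable (from a countable set) and $t$ a basic term. Let $\leadsto$ be the relation $t[\alpha]\leadsto\alpha$; $\mathsf s(\alpha)\leadsto\alpha$; $\mathsf p(\alpha)\leadsto\alpha$;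 $tu[\alpha]\leadsto t[u[\alpha]]$; $t^{o}[\alpha]\leadsto t[\alpha]$; $t^{r}[\alpha]\leadsto t[t^{r}[\alpha]]$ and $t^{r}[\alpha]\leadsto t[\mathsf s(t^{r}[\alpha])]$; $t^{\ell}[\alpha]\leadsto t[t^{\ell}[\alpha]]$ and $t^{\ell}[\alpha]\leadsto t[\mathsf p(t^{\ell}[\alpha])]$; $t[\alpha]\leadsto t[\mathsf{last}(t)]$. Fix basic terms $t_1,\dots,t_n$ ($n\ge1$) and a time variable $\kappa$, and let $\Delta$ be the (finite) set of samples reachable from $t_1[\kappa],\dots,t_n[\kappa]$ by the reflexive transitive closure of $\leadsto$. **The formula.** Let $\tau$ have binary relation symbols $\preceq,\mathsf S$ and unary relation symbols $\mathsf O,\mathsf I$; write $a\prec b$ for $a\preceq b\wedge\neg(b\preceq a)$. Let $\psi$ be the quantifier-free $\tau$-formula with variables in $\Delta$ that is the conjunction of the following formulas, for all basic terms $t,u$ and samples $\alpha,\beta$ such that the indicated samples lie in $\Delta$. * Structure: $\alpha\preceq\beta\Rightarrow t[\alpha]\preceq t[\beta]$ and $\mathsf I(\alpha)\Rightarrow\mathsf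 I(t[\alpha])$ (for $t[\alpha],t[\beta]\in\Delta$); $\mathsf S(\mathsf p(\alpha),\alpha)\vee(\mathsf I(\mathsf p(\alpha))\wedge\mathsf I(\alpha))$ ($\mathsf p(\alpha)\in\Delta$); $\mathsf S(\alpha,\mathsf s(\alpha))$ ($\mathsf s(\alpha)\in\Delta$); $\mathsf{last}(t)\preceq\alpha\Leftrightarrow t[\alpha]=t[\mathsf{last}(t)]$ ($t[\alpha]\in\Delta$); $\mathsf O(\mathsf{last}(t))\Rightarrow\mathsf O(t[\mathsf{last}(t)])$ ($t[\mathsf{last}(t)]\in\Delta$). * Logic: $\mathrm{id}[\alpha]=\alpha$ ($\mathrm{id}[\alpha]\in\Delta$); $\mathsf I(\mathsf{last}(\bot))$ (if some $\bot[\alpha]\in\Delta$); $tu[\alpha]=t[u[\alpha]]$ ($tu[\alpha]\in\Delta$); $\mathsf O(\mathsf{last}(tu))\Rightarrow\mathsf O(\mathsf{last}(t))\wedge\mathsf O(\mathsf{last}(u))$ ($tu[\mathsf{last}(tu)]\in\Delta$). * Bounds: $\mathsf I(t^{o}[\alpha])\vee\mathsf O(t^{o}[\alpha])$ and $\neg\mathsf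 O(\alpha)\Rightarrow(\mathsf O(t^{o}[\alpha])\Leftrightarrow\mathsf O(t[\alpha]))$ ($t^{o}[\alpha]\in\Delta$); $\neg\mathsf O(\mathsf{last}(t^{o}))$ ($\mathsf{last}(t^{o})\in\Delta$); $\neg\mathsf O(t^{o}[\mathsf{last}(t^{o})])\wedge\neg\mathsf O(\alpha)\Rightarrow\neg\mathsf O(t[\alpha])$ ($t[\alpha],t^{o}[\mathsf{last}(t^{o})]\in\Delta$). * Right: $t[t^{r}[\alpha]]\preceq\alpha$ ($t[t^{r}[\alpha]]\in\Delta$); $\neg\mathsf I(\alpha)\wedge\neg\mathsf O(\alpha)\wedge\neg\mathsf O(t^{r}[\alpha])\Rightarrow\alpha\prec t[\mathsf s(t^{r}[\alpha])]$ ($t[\mathsf s(t^{r}[\alpha])]\in\Delta$); $\mathsf O(\mathsf{last}(t^{r}))\Rightarrow\mathsf O(\mathsf{last}(t))$ ($t^{r}[\mathsf{last}(t^{r})]\in\Delta$); $\neg\mathsf O(t^{r}[\mathsf{last}(t^{r})])\Rightarrow\mathsf O(t[\mathsf s(t^{r}[\mathsf{last}(t^{r})])])$ ($t[\mathsf s(t^{r}[\mathsf{last}(t^{r})])]\in\Delta$).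 * Left: $\neg\mathsf O(t^{\ell}[\alpha])\Rightarrow\alpha\preceq t[t^{\ell}[\alpha]]$ and $\neg\mathsf O(\alpha)\wedge\mathsf O(t^{\ell}[\alpha])\Rightarrow t[t^{\ell}[\alpha]]\prec\alpha$ ($t[t^{\ell}[\alpha]]\in\Delta$); $\neg\mathsf I(\alpha)\wedge\neg\mathsf O(\alpha)\wedge\neg\mathsf O(t^{\ell}[\alpha])\Rightarrow t[\mathsf p(t^{\ell}[\alpha])]\prec\alpha$ ($t[\mathsf p(t^{\ell}[\alpha])]\in\Delta$); $\mathsf O(\mathsf{last}(t^{\ell}))\Rightarrow\mathsf O(\mathsf{last}(t))$ and $\neg\mathsf O(t^{\ell}[\mathsf{last}(t^{\ell})])\Rightarrow\mathsf O(t[t^{\ell}[\mathsf{last}(t^{\ell})]])$ ($t^{\ell}[\mathsf{last}(t^{\ell})]\in\Delta$). * Failure: $t_i[\kappa]\prec\kappa$ for $1\le i\le n$. Let $\sigma$ have binary relation symbols $\le,S$ and a constant $0$, and regard $\mathbb N$ as the $\sigma$-structure with its usual order, $S=\{(m,m+1)\mid m\in\mathbb N\}$ and $0$. Let $\varphi$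 be the $\sigma$-formula obtained from $\psi$ by replacing each atom $\mathsf O(x)$ by $x=0$; $\mathsf I(x)$ by $S(0,x)$; $\mathsf S(x,y)$ by $(x=0\wedge y=0)\vee(\neg(x=0)\wedge S(x,y))$; $x\preceq y$ by $y=0\vee(\neg(x=0)\wedge x\le y)$. **Theorem.** For all basic terms $t_1,\dots,t_n$ with $n\ge 1$ and every time variable $\kappa$, the $\sigma$-formula $\varphi$ is quantifier-free, and the equation $\mathrm{id}\le t_1\vee\dots\vee t_n$ is valid in $\mathbf W$ if and only if $\varphi$ is unsatisfiable in $\mathbb N$. Moreover, any $w\colon\Delta\to\mathbb N$ with $\mathbb N,w\models\varphi$ effectively yields a valuation $\theta$ of the variables in time warps under which $\mathrm{id}\le t_1\vee\dots\vee t_n$ fails: there is a single computable function that, for all $t_1,\dots,t_n$ and $\kappa$, given (Gödel numbers of) any finite listing of the graph of such a $w$ and a variable $x$, returns a program that computes the time warp $\theta(x)$ on all of $\omega^+$, where elements of $\omega^+$ are represented by natural numbers via the bijection $\iota\colon\mathbb N\to\omega^+$, $\iota(0)=\omega$, $\iota(m+1)=m$. -/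

import Mathlib

/-! ## The time warp algebra -/

/-- Time warps: functions on `ω ∪ {ω}` that preserve arbitrary suprema. Composition, identity,
least element and pointwise order are those of `sSupHom`. -/
abbrev TimeWarp : Type := sSupHom ℕ∞ ℕ∞

namespace TimeWarp

/-- The pointwise supremum of a set of time warps, the supremum in the lattice of time warps. -/
noncomputable def sup (A : Set TimeWarp) : TimeWarp where
  toFun p := ⨆ f ∈ A, f p
  map_sSup' S := by
    rw [sSup_image]
    simp only [map_sSup, sSup_image]
    apply le_antisymm
    · exact iSup₂_le fun f hf => iSup₂_le fun p hp =>
        le_iSup₂_of_le p hp (le_iSup₂_of_le (f := fun (f : TimeWarp) (_ : f ∈ A) => f p) f hf le_rfl)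
    · exact iSup₂_le fun p hp => iSup₂_le fun f hf =>
        le_iSup₂_of_le f hf (le_iSup₂_of_le (f := fun (p : ℕ∞) (_ : p ∈ S) => f p) p hp le_rfl)

noncomputable def join (f g : TimeWarp) : TimeWarp := sup {f, g}

theorem monotone (f : TimeWarp) : Monotone f := OrderHomClass.mono f

noncomputable def meet (f g : TimeWarp) : TimeWarp where
  toFun p := f p ⊓ g p
  map_sSup' S := by
    rw [sSup_image]
    simp only [map_sSup, sSup_image]
    apply le_antisymm
    · rw [iSup₂_inf_eq]
      refine iSup₂_le fun p hp => ?_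
      rw [inf_iSup₂_eq]
      refine iSup₂_le fun q hq => ?_
      rcases le_total p q with h | h
      · exact le_iSup₂_of_le q hq (inf_le_inf (monotone f h) le_rfl)
      · exact le_iSup₂_of_le p hp (inf_le_inf le_rfl (monotone g h))
    · exact iSup₂_le fun p hp => inf_le_inf
        (le_iSup₂_of_le (f := fun (p : ℕ∞) (_ : p ∈ S) => f p) p hp le_rfl)
        (le_iSup₂_of_le (f := fun (p : ℕ∞) (_ : p ∈ S) => g p) p hp le_rfl)

/-- The greatest time warp (it maps every `p ≠ 0` to `ω`). -/
noncomputable def top : TimeWarp := sup Set.univ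

/-- The residual `f \ h`, the greatest `g` with `f ∘ g ≤ h`. -/
noncomputable def ldiv (f h : TimeWarp) : TimeWarp := sup {g | f.comp g ≤ h}

/-- The residual `h / g`, the greatest `f` with `f ∘ g ≤ h`. -/
noncomputable def rdiv (h g : TimeWarp) : TimeWarp := sup {f | f.comp g ≤ h}

theorem le_sup {A : Set TimeWarp} {f : TimeWarp} (hf : f ∈ A) : f ≤ sup A := fun p =>
  le_iSup₂_of_le (f := fun (f : TimeWarp) (_ : f ∈ A) => f p) f hf le_rfl

theorem le_ldiv_iff (f g h : TimeWarp) : g ≤ ldiv f h ↔ f.comp g ≤ h := by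
  refine ⟨fun hg p => ?_, fun hg => le_sup hg⟩
  have h1 : f (g p) ≤ f (⨆ k ∈ {k : TimeWarp | f.comp k ≤ h}, k p) := monotone f (hg p)
  refine h1.trans ?_
  rw [map_iSup₂]
  exact iSup₂_le fun k hk => hk p

theorem le_rdiv_iff (f g h : TimeWarp) : f ≤ rdiv h g ↔ f.comp g ≤ h := by
  refine ⟨fun hf p => ?_, fun hf => le_sup hf⟩
  exact (hf (g p)).trans (iSup₂_le fun k hk => hk p)

end TimeWarp

/-! ## Terms, equations, basic terms -/

inductive WarpTerm : Type
  | var (x : ℕ)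
  | meet (s t : WarpTerm)
  | join (s t : WarpTerm)
  | comp (s t : WarpTerm)
  | ldiv (s t : WarpTerm)
  | rdiv (s t : WarpTerm)
  | ident
  | bot
  | top

noncomputable def WarpTerm.eval (θ : ℕ → TimeWarp) : WarpTerm → TimeWarp
  | var x => θ x
  | meet s t => (s.eval θ).meet (t.eval θ)
  | join s t => (s.eval θ).join (t.eval θ)
  | comp s t => sSupHom.comp (s.eval θ) (t.eval θ)
  | ldiv s t => (s.eval θ).ldiv (t.eval θ)
  | rdiv s t => (s.eval θ).rdiv (t.eval θ)
  | ident => sSupHom.id ℕ∞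
  | bot => ⊥
  | top => TimeWarp.top

structure WarpEquation : Type where
  lhs : WarpTerm
  rhs : WarpTerm

namespace WarpEquation

/-- `s ≤ t` stands for the equation `s ∧ t ≈ s`. -/
def le (s t : WarpTerm) : WarpEquation := ⟨s.meet t, s⟩

/-- The equation holds in the time warp algebra under the valuation `θ`. -/
def Holds (θ : ℕ → TimeWarp) (e : WarpEquation) : Prop := e.lhs.eval θ = e.rhs.eval θ

def Valid (e : WarpEquation) : Prop := ∀ θ : ℕ → TimeWarp, e.Holds θ

end WarpEquation

inductive BasicTerm : Type
  | var (x : ℕ)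
  | comp (t u : BasicTerm)
  | o (t : BasicTerm)
  | l (t : BasicTerm)
  | r (t : BasicTerm)
  | ident
  | bot

/-- A basic term as a time warp term: `tᵒ = ⊤ \ t`, `tˡ = id / t`, `tʳ = t \ id`. -/
def BasicTerm.toTerm : BasicTerm → WarpTerm
  | var x => .var x
  | comp t u => .comp t.toTerm u.toTerm
  | o t => .ldiv .top t.toTerm
  | l t => .rdiv .ident t.toTerm
  | r t => .ldiv t.toTerm .ident
  | ident => .ident
  | bot => .bot

/-- The term `t₁ ∨ ⋯ ∨ tₙ`. -/
def joinTerm : List BasicTerm → WarpTerm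
  | [] => .bot
  | [t] => t.toTerm
  | t :: u :: ts => .join t.toTerm (joinTerm (u :: ts))

/-- The equation `id ≤ t₁ ∨ ⋯ ∨ tₙ`. -/
def idLeJoin (ts : List BasicTerm) : WarpEquation := WarpEquation.le .ident (joinTerm ts)

/-! ## Samples and saturation -/

/-- Samples: time variables, `t[α]`, `s(α)`, `p(α)` and `last(t)`. -/
inductive Sample : Type
  | tvar (κ : ℕ)
  | app (t : BasicTerm) (α : Sample)
  | suc (α : Sample)
  | pre (α : Sample)
  | last (t : BasicTerm)

namespace Sample

inductive Step : Sample → Sample → Prop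
  | arg (t : BasicTerm) (α : Sample) : Step (app t α) α
  | suc (α : Sample) : Step (suc α) α
  | pre (α : Sample) : Step (pre α) α
  | comp (t u : BasicTerm) (α : Sample) : Step (app (.comp t u) α) (app t (app u α))
  | o (t : BasicTerm) (α : Sample) : Step (app (.o t) α) (app t α)
  | r (t : BasicTerm) (α : Sample) : Step (app (.r t) α) (app t (app (.r t) α))
  | rSuc (t : BasicTerm) (α : Sample) : Step (app (.r t) α) (app t (.suc (app (.r t) α)))
  | l (t : BasicTerm) (α : Sample) : Step (app (.l t) α) (app t (app (.l t) α))
  | lPre (t : BasicTerm) (α : Sample) : Step (app (.l t) α) (app t (.pre (app (.l t) α)))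
  | last (t : BasicTerm) (α : Sample) : Step (app t α) (app t (.last t))

def Saturated (Δ : Set Sample) : Prop := ∀ ⦃α β : Sample⦄, α ∈ Δ → Step α β → β ∈ Δ

def saturation (Δ : Set Sample) : Set Sample :=
  {β | ∃ α ∈ Δ, Relation.ReflTransGen Step α β}

theorem saturated_saturation (Δ : Set Sample) : Saturated (saturation Δ) := by
  rintro α β ⟨γ, hγ, h⟩ hs
  exact ⟨γ, hγ, h.tail hs⟩

theorem subset_saturation (Δ : Set Sample) : Δ ⊆ saturation Δ := fun α h => ⟨α, h, .refl⟩

theorem exists_finite_closure (t : BasicTerm) : ∀ α : Sample, ∃ E : Set Sample, E.Finite ∧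
    app t α ∈ E ∧ ∀ β ∈ E, ∀ γ, Step β γ → γ ∈ E ∨ γ = α := by
  induction t with
  | var x =>
    intro α
    refine ⟨{app (.var x) α, app (.var x) (last (.var x)), last (.var x)}, by simp, by simp, ?_⟩
    rintro β (rfl | rfl | rfl) γ h <;> cases h <;> simp
  | ident =>
    intro α
    refine ⟨{app .ident α, app .ident (last .ident), last .ident}, by simp, by simp, ?_⟩
    rintro β (rfl | rfl | rfl) γ h <;> cases h <;> simp
  | bot =>
    intro α
    refine ⟨{app .bot α, app .bot (last .bot), last .bot}, by simp, by simp, ?_⟩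
    rintro β (rfl | rfl | rfl) γ h <;> cases h <;> simp
  | comp t u iht ihu =>
    intro α
    obtain ⟨A, fA, mA, cA⟩ := iht (app u α)
    obtain ⟨B, fB, mB, cB⟩ := ihu α
    obtain ⟨C, fC, mC, cC⟩ := iht (app u (last (.comp t u)))
    obtain ⟨D, fD, mD, cD⟩ := ihu (last (.comp t u))
    refine ⟨{app (.comp t u) α, app (.comp t u) (last (.comp t u)), last (.comp t u)} ∪
      (A ∪ B ∪ (C ∪ D)), ?_, by simp, ?_⟩
    · exact (Set.toFinite _).union ((fA.union fB).union (fC.union fD))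
    · rintro β ((rfl | rfl | rfl) | ((h | h) | (h | h))) γ hs
      · cases hs <;> simp [mA]
      · cases hs <;> simp [mC]
      · cases hs
      · rcases cA β h γ hs with h' | rfl <;> simp [*]
      · rcases cB β h γ hs with h' | rfl <;> simp [*]
      · rcases cC β h γ hs with h' | rfl <;> simp [*]
      · rcases cD β h γ hs with h' | rfl <;> simp [*]
  | o t ih =>
    intro α
    obtain ⟨A, fA, mA, cA⟩ := ih α
    obtain ⟨B, fB, mB, cB⟩ := ih (last (.o t))
    refine ⟨{app (.o t) α, app (.o t) (last (.o t)), last (.o t)} ∪ (A ∪ B), ?_, by simp, ?_⟩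
    · exact (Set.toFinite _).union (fA.union fB)
    · rintro β ((rfl | rfl | rfl) | (h | h)) γ hs
      · cases hs <;> simp [mA]
      · cases hs <;> simp [mB]
      · cases hs
      · rcases cA β h γ hs with h' | rfl <;> simp [*]
      · rcases cB β h γ hs with h' | rfl <;> simp [*]
  | r t ih =>
    intro α
    obtain ⟨A, fA, mA, cA⟩ := ih (app (.r t) α)
    obtain ⟨B, fB, mB, cB⟩ := ih (suc (app (.r t) α))
    obtain ⟨C, fC, mC, cC⟩ := ih (app (.r t) (last (.r t)))
    obtain ⟨D, fD, mD, cD⟩ := ih (suc (app (.r t) (last (.r t))))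
    refine ⟨{app (.r t) α, app (.r t) (last (.r t)), last (.r t), suc (app (.r t) α),
      suc (app (.r t) (last (.r t)))} ∪ (A ∪ B ∪ (C ∪ D)), ?_, by simp, ?_⟩
    · exact (Set.toFinite _).union ((fA.union fB).union (fC.union fD))
    · rintro β ((rfl | rfl | rfl | rfl | rfl) | ((h | h) | (h | h))) γ hs
      · cases hs <;> simp [mA, mB]
      · cases hs <;> simp [mC, mD]
      · cases hs
      · cases hs; simp
      · cases hs; simp
      · rcases cA β h γ hs with h' | rfl <;> simp [*]
      · rcases cB β h γ hs with h' | rfl <;> simp [*]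
      · rcases cC β h γ hs with h' | rfl <;> simp [*]
      · rcases cD β h γ hs with h' | rfl <;> simp [*]
  | l t ih =>
    intro α
    obtain ⟨A, fA, mA, cA⟩ := ih (app (.l t) α)
    obtain ⟨B, fB, mB, cB⟩ := ih (pre (app (.l t) α))
    obtain ⟨C, fC, mC, cC⟩ := ih (app (.l t) (last (.l t)))
    obtain ⟨D, fD, mD, cD⟩ := ih (pre (app (.l t) (last (.l t))))
    refine ⟨{app (.l t) α, app (.l t) (last (.l t)), last (.l t), pre (app (.l t) α),
      pre (app (.l t) (last (.l t)))} ∪ (A ∪ B ∪ (C ∪ D)), ?_, by simp, ?_⟩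
    · exact (Set.toFinite _).union ((fA.union fB).union (fC.union fD))
    · rintro β ((rfl | rfl | rfl | rfl | rfl) | ((h | h) | (h | h))) γ hs
      · cases hs <;> simp [mA, mB]
      · cases hs <;> simp [mC, mD]
      · cases hs
      · cases hs; simp
      · cases hs; simp
      · rcases cA β h γ hs with h' | rfl <;> simp [*]
      · rcases cB β h γ hs with h' | rfl <;> simp [*]
      · rcases cC β h γ hs with h' | rfl <;> simp [*]
      · rcases cD β h γ hs with h' | rfl <;> simp [*]

/-- The saturation `Δ` of `{t₁[κ], …, tₙ[κ]}`. -/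
def diagramDomain (κ : ℕ) (ts : List BasicTerm) : Set Sample :=
  saturation {α | ∃ t ∈ ts, α = app t (tvar κ)}

theorem diagramDomain_finite (κ : ℕ) (ts : List BasicTerm) : (diagramDomain κ ts).Finite := by
  choose E hfin hmem hcl using fun t => exists_finite_closure t (tvar κ)
  have hF : ((⋃ t ∈ {t | t ∈ ts}, E t) ∪ {tvar κ}).Finite :=
    ((List.finite_toSet ts).biUnion fun t _ => hfin t).union (Set.finite_singleton _)
  refine hF.subset ?_
  rintro β ⟨α, ⟨t, ht, rfl⟩, h⟩
  induction h with
  | refl => exact Or.inl (Set.mem_biUnion (x := t) ht (hmem t))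
  | tail _ hs ih =>
    rcases ih with ih | ih
    · simp only [Set.mem_iUnion] at ih
      obtain ⟨u, hu, hb⟩ := ih
      rcases hcl u _ hb _ hs with h' | h'
      · exact Or.inl (Set.mem_biUnion (x := u) hu h')
      · exact Or.inr h'
    · cases ih; cases hs

instance (κ : ℕ) (ts : List BasicTerm) : Finite (diagramDomain κ ts) :=
  (diagramDomain_finite κ ts).to_subtype

end Sample

/-! ## The two signatures -/

/-- The relation symbols of `τ`: `I` ("is zero"), `O` ("is `ω`"), order and successor. -/
inductive TauRel : ℕ → Type
  | I : TauRel 1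
  | O : TauRel 1
  | le : TauRel 2
  | S : TauRel 2

def tau : FirstOrder.Language := ⟨fun _ => Empty, TauRel⟩

inductive SigmaFun : ℕ → Type
  | zero : SigmaFun 0

inductive SigmaRel : ℕ → Type
  | le : SigmaRel 2
  | S : SigmaRel 2

def sigma : FirstOrder.Language := ⟨SigmaFun, SigmaRel⟩

/-- The standard `σ`-structure `(ℕ, ≤, S, 0)`; `S` is the successor relation. -/
instance sigmaNat : sigma.Structure ℕ where
  funMap f _ := match f with
    | SigmaFun.zero => 0
  RelMap R v := match R, v with
    | SigmaRel.le, v => v 0 ≤ v 1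
    | SigmaRel.S, v => v 1 = v 0 + 1

namespace tau

variable {V : Type}

/-- A variable as a term. -/
def v (x : V) : tau.Term (V ⊕ Fin 0) := .var (.inl x)

def I (x : V) : tau.Formula V := FirstOrder.Language.BoundedFormula.rel TauRel.I ![v x]

def O (x : V) : tau.Formula V := FirstOrder.Language.BoundedFormula.rel TauRel.O ![v x]

def S (x y : V) : tau.Formula V := FirstOrder.Language.BoundedFormula.rel TauRel.S ![v x, v y]

def le (x y : V) : tau.Formula V := FirstOrder.Language.BoundedFormula.rel TauRel.le ![v x, v y]

def eq (x y : V) : tau.Formula V := .equal (v x) (v y)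

def lt (x y : V) : tau.Formula V := le x y ⊓ (le y x).not

end tau

/-! ## Replacing `τ`-atoms by `σ`-formulas -/

def tauTermToSigma {V : Type} : tau.Term V → sigma.Term V
  | .var x => .var x
  | .func f _ => nomatch f

def sigmaZero {V : Type} : sigma.Term V := .func SigmaFun.zero ![]

/-- The replacement of the atomic `τ`-formulas `I(x)`, `O(x)`, `x ≼ y`, `S(x, y)`. -/
def tauAtomToSigma {V : Type} {n l : ℕ} (R : TauRel l) (ts : Fin l → sigma.Term (V ⊕ Fin n)) :
    sigma.BoundedFormula V n :=
  match R, ts with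
  | .O, ts => .equal (ts 0) sigmaZero
  | .I, ts => .rel SigmaRel.S ![sigmaZero, ts 0]
  | .S, ts =>
      (.equal (ts 0) sigmaZero ⊓ .equal (ts 1) sigmaZero) ⊔
        ((FirstOrder.Language.BoundedFormula.equal (ts 0) sigmaZero).not ⊓
          .rel SigmaRel.S ![ts 0, ts 1])
  | .le, ts =>
      .equal (ts 1) sigmaZero ⊔
        ((FirstOrder.Language.BoundedFormula.equal (ts 0) sigmaZero).not ⊓
          .rel SigmaRel.le ![ts 0, ts 1])

/-- The `σ`-formula `χ'` obtained from a `τ`-formula `χ` (only used for quantifier-free `χ`). -/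
def tauToSigma {V : Type} : {n : ℕ} → tau.BoundedFormula V n → sigma.BoundedFormula V n
  | _, .falsum => .falsum
  | _, .equal s t => .equal (tauTermToSigma s) (tauTermToSigma t)
  | _, .rel R ts => tauAtomToSigma R fun i => tauTermToSigma (ts i)
  | _, .imp χ₁ χ₂ => .imp (tauToSigma χ₁) (tauToSigma χ₂)
  | _, .all χ => .all (tauToSigma χ)

/-! ## The formula expressing the existence of a refuting diagram -/

namespace Sample

namespace Saturated

variable {Δ : Set Sample} {t u : BasicTerm} {α : Sample}

theorem arg (hΔ : Saturated Δ) (h : app t α ∈ Δ) : α ∈ Δ := hΔ h (.arg t α)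
theorem ofSuc (hΔ : Saturated Δ) (h : suc α ∈ Δ) : α ∈ Δ := hΔ h (.suc α)
theorem ofPre (hΔ : Saturated Δ) (h : pre α ∈ Δ) : α ∈ Δ := hΔ h (.pre α)
theorem comp (hΔ : Saturated Δ) (h : app (.comp t u) α ∈ Δ) : app t (app u α) ∈ Δ := hΔ h (.comp t u α)
theorem o (hΔ : Saturated Δ) (h : app (.o t) α ∈ Δ) : app t α ∈ Δ := hΔ h (.o t α)
theorem r (hΔ : Saturated Δ) (h : app (.r t) α ∈ Δ) : app t (app (.r t) α) ∈ Δ := hΔ h (.r t α)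
theorem l (hΔ : Saturated Δ) (h : app (.l t) α ∈ Δ) : app t (app (.l t) α) ∈ Δ := hΔ h (.l t α)
theorem appLast (hΔ : Saturated Δ) (h : app t α ∈ Δ) : app t (last t) ∈ Δ := hΔ h (.last t α)
theorem last (hΔ : Saturated Δ) (h : app t α ∈ Δ) : Sample.last t ∈ Δ := hΔ.arg (hΔ.appLast h)

end Saturated

open tau

variable {Δ : Set Sample}

def structSet (hΔ : Saturated Δ) : Set (tau.Formula Δ) :=
  {χ | ∃ (t : BasicTerm) (α β : Sample) (h : app t α ∈ Δ) (k : app t β ∈ Δ),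
    χ = (le ⟨α, hΔ.arg h⟩ ⟨β, hΔ.arg k⟩).imp (le ⟨app t α, h⟩ ⟨app t β, k⟩)} ∪
  {χ | ∃ (t : BasicTerm) (α : Sample) (h : app t α ∈ Δ),
    χ = (I ⟨α, hΔ.arg h⟩).imp (I ⟨app t α, h⟩)} ∪
  {χ | ∃ (α : Sample) (h : pre α ∈ Δ),
    χ = S ⟨pre α, h⟩ ⟨α, hΔ.ofPre h⟩ ⊔ (I ⟨pre α, h⟩ ⊓ I ⟨α, hΔ.ofPre h⟩)} ∪
  {χ | ∃ (α : Sample) (h : suc α ∈ Δ), χ = S ⟨α, hΔ.ofSuc h⟩ ⟨suc α, h⟩} ∪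
  {χ | ∃ (t : BasicTerm) (α : Sample) (h : app t α ∈ Δ),
    χ = (le ⟨last t, hΔ.last h⟩ ⟨α, hΔ.arg h⟩).iff
      (eq ⟨app t α, h⟩ ⟨app t (last t), hΔ.appLast h⟩)} ∪
  {χ | ∃ (t : BasicTerm) (h : app t (last t) ∈ Δ),
    χ = (O ⟨last t, hΔ.arg h⟩).imp (O ⟨app t (last t), h⟩)}

def logSet (hΔ : Saturated Δ) : Set (tau.Formula Δ) :=
  {χ | ∃ (α : Sample) (h : app .ident α ∈ Δ), χ = eq ⟨app .ident α, h⟩ ⟨α, hΔ.arg h⟩} ∪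
  {χ | ∃ (α : Sample) (h : app .bot α ∈ Δ), χ = I ⟨last .bot, hΔ.last h⟩} ∪
  {χ | ∃ (t u : BasicTerm) (α : Sample) (h : app (.comp t u) α ∈ Δ),
    χ = eq ⟨app (.comp t u) α, h⟩ ⟨app t (app u α), hΔ.comp h⟩} ∪
  {χ | ∃ (t u : BasicTerm) (h : app (.comp t u) (last (.comp t u)) ∈ Δ),
    χ = (O ⟨last (.comp t u), hΔ.arg h⟩).imp
      (O ⟨last t, hΔ.last (hΔ.comp h)⟩ ⊓ O ⟨last u, hΔ.last (hΔ.arg (hΔ.comp h))⟩)}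

def boundsSet (hΔ : Saturated Δ) : Set (tau.Formula Δ) :=
  {χ | ∃ (t : BasicTerm) (α : Sample) (h : app (.o t) α ∈ Δ),
    χ = I ⟨app (.o t) α, h⟩ ⊔ O ⟨app (.o t) α, h⟩} ∪
  {χ | ∃ (t : BasicTerm) (α : Sample) (h : app (.o t) α ∈ Δ),
    χ = (O ⟨α, hΔ.arg h⟩).not.imp ((O ⟨app (.o t) α, h⟩).iff (O ⟨app t α, hΔ.o h⟩))} ∪
  {χ | ∃ (t : BasicTerm) (h : last (.o t) ∈ Δ), χ = (O ⟨last (.o t), h⟩).not} ∪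
  {χ | ∃ (t : BasicTerm) (α : Sample) (h : app t α ∈ Δ) (k : app (.o t) (last (.o t)) ∈ Δ),
    χ = ((O ⟨app (.o t) (last (.o t)), k⟩).not ⊓ (O ⟨α, hΔ.arg h⟩).not).imp
      (O ⟨app t α, h⟩).not}

def rightSet (hΔ : Saturated Δ) : Set (tau.Formula Δ) :=
  {χ | ∃ (t : BasicTerm) (α : Sample) (h : app t (app (.r t) α) ∈ Δ),
    χ = le ⟨app t (app (.r t) α), h⟩ ⟨α, hΔ.arg (hΔ.arg h)⟩} ∪
  {χ | ∃ (t : BasicTerm) (α : Sample) (h : app t (suc (app (.r t) α)) ∈ Δ),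
    χ = ((I ⟨α, hΔ.arg (hΔ.ofSuc (hΔ.arg h))⟩).not ⊓
        (O ⟨α, hΔ.arg (hΔ.ofSuc (hΔ.arg h))⟩).not ⊓
        (O ⟨app (.r t) α, hΔ.ofSuc (hΔ.arg h)⟩).not).imp
      (lt ⟨α, hΔ.arg (hΔ.ofSuc (hΔ.arg h))⟩ ⟨app t (suc (app (.r t) α)), h⟩)} ∪
  {χ | ∃ (t : BasicTerm) (h : app (.r t) (last (.r t)) ∈ Δ),
    χ = (O ⟨last (.r t), hΔ.arg h⟩).imp (O ⟨last t, hΔ.last (hΔ.r h)⟩)} ∪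
  {χ | ∃ (t : BasicTerm) (h : app t (suc (app (.r t) (last (.r t)))) ∈ Δ),
    χ = (O ⟨app (.r t) (last (.r t)), hΔ.ofSuc (hΔ.arg h)⟩).not.imp
      (O ⟨app t (suc (app (.r t) (last (.r t)))), h⟩)}

def leftSet (hΔ : Saturated Δ) : Set (tau.Formula Δ) :=
  {χ | ∃ (t : BasicTerm) (α : Sample) (h : app t (app (.l t) α) ∈ Δ),
    χ = (O ⟨app (.l t) α, hΔ.arg h⟩).not.imp
      (le ⟨α, hΔ.arg (hΔ.arg h)⟩ ⟨app t (app (.l t) α), h⟩)} ∪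
  {χ | ∃ (t : BasicTerm) (α : Sample) (h : app t (pre (app (.l t) α)) ∈ Δ),
    χ = ((I ⟨α, hΔ.arg (hΔ.ofPre (hΔ.arg h))⟩).not ⊓
        (O ⟨α, hΔ.arg (hΔ.ofPre (hΔ.arg h))⟩).not ⊓
        (O ⟨app (.l t) α, hΔ.ofPre (hΔ.arg h)⟩).not).imp
      (lt ⟨app t (pre (app (.l t) α)), h⟩ ⟨α, hΔ.arg (hΔ.ofPre (hΔ.arg h))⟩)} ∪
  {χ | ∃ (t : BasicTerm) (α : Sample) (h : app t (app (.l t) α) ∈ Δ),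
    χ = ((O ⟨α, hΔ.arg (hΔ.arg h)⟩).not ⊓ O ⟨app (.l t) α, hΔ.arg h⟩).imp
      (lt ⟨app t (app (.l t) α), h⟩ ⟨α, hΔ.arg (hΔ.arg h)⟩)} ∪
  {χ | ∃ (t : BasicTerm) (h : app (.l t) (last (.l t)) ∈ Δ),
    χ = (O ⟨last (.l t), hΔ.arg h⟩).imp (O ⟨last t, hΔ.last (hΔ.l h)⟩)} ∪
  {χ | ∃ (t : BasicTerm) (h : app (.l t) (last (.l t)) ∈ Δ),
    χ = (O ⟨app (.l t) (last (.l t)), h⟩).not.imp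
      (O ⟨app t (app (.l t) (last (.l t))), hΔ.l h⟩)}

/-- The failure of `id ≤ t₁ ∨ ⋯ ∨ tₙ` at the time variable `κ`. -/
def failSet (hΔ : Saturated Δ) (κ : ℕ) (ts : List BasicTerm) : Set (tau.Formula Δ) :=
  {χ | ∃ t ∈ ts, ∃ h : app t (tvar κ) ∈ Δ, χ = lt ⟨app t (tvar κ), h⟩ ⟨tvar κ, hΔ.arg h⟩}

def psiSet (hΔ : Saturated Δ) (κ : ℕ) (ts : List BasicTerm) : Set (tau.Formula Δ) :=
  structSet hΔ ∪ logSet hΔ ∪ boundsSet hΔ ∪ rightSet hΔ ∪ leftSet hΔ ∪ failSet hΔ κ ts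

theorem finite_family {ι X : Type} [Finite Δ] (e : ι → Sample) (he : Function.Injective e)
    (f : ∀ i, e i ∈ Δ → X) : {χ | ∃ (i : ι) (h : e i ∈ Δ), χ = f i h}.Finite := by
  have : Finite {i // e i ∈ Δ} := Finite.of_injective
    (fun i : {i // e i ∈ Δ} => (⟨e i, i.2⟩ : Δ)) fun i j h => Subtype.ext (he (by simpa using h))
  refine (Set.finite_range fun i : {i // e i ∈ Δ} => f i i.2).subset ?_
  rintro χ ⟨i, h, rfl⟩
  exact ⟨⟨i, h⟩, rfl⟩

theorem finite_family₂ {ι ι' X : Type} [Finite Δ] (e : ι → ι' → Sample)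
    (he : Function.Injective2 e) (f : ∀ i j, e i j ∈ Δ → X) :
    {χ | ∃ (i : ι) (j : ι') (h : e i j ∈ Δ), χ = f i j h}.Finite := by
  refine (finite_family (fun p : ι × ι' => e p.1 p.2)
    (fun p q h => Prod.ext (he h).1 (he h).2) fun p h => f p.1 p.2 h).subset ?_
  rintro χ ⟨i, j, h, rfl⟩
  exact ⟨(i, j), h, rfl⟩

theorem psiSet_finite [Finite Δ] (hΔ : Saturated Δ) (κ : ℕ) (ts : List BasicTerm) :
    (psiSet hΔ κ ts).Finite := by
  have hs : (structSet hΔ).Finite := by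
    refine ((((Set.Finite.union ?_ ?_).union ?_).union ?_).union ?_).union ?_
    · have hI : Finite {p : (BasicTerm × Sample) × (BasicTerm × Sample) //
          app p.1.1 p.1.2 ∈ Δ ∧ app p.2.1 p.2.2 ∈ Δ} := Finite.of_injective
        (fun p => ((⟨_, p.2.1⟩, ⟨_, p.2.2⟩) : Δ × Δ)) (by
          rintro ⟨⟨⟨a, b⟩, c, d⟩, _⟩ ⟨⟨⟨a', b'⟩, c', d'⟩, _⟩ h
          simp only [Prod.mk.injEq, Subtype.mk.injEq, app.injEq] at h
          obtain ⟨⟨rfl, rfl⟩, rfl, rfl⟩ := h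
          rfl)
      refine (Set.finite_range fun p : {p : (BasicTerm × Sample) × (BasicTerm × Sample) //
          app p.1.1 p.1.2 ∈ Δ ∧ app p.2.1 p.2.2 ∈ Δ} =>
        (le ⟨p.1.1.2, hΔ.arg p.2.1⟩ ⟨p.1.2.2, hΔ.arg p.2.2⟩).imp
          (le ⟨app p.1.1.1 p.1.1.2, p.2.1⟩ ⟨app p.1.2.1 p.1.2.2, p.2.2⟩)).subset ?_
      rintro χ ⟨t, α, β, h, k, rfl⟩
      exact ⟨⟨((t, α), (t, β)), h, k⟩, rfl⟩
    · exact finite_family₂ app (fun a b c d h => by simpa using h) _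
    · exact finite_family pre (fun a b h => by simpa using h) _
    · exact finite_family suc (fun a b h => by simpa using h) _
    · exact finite_family₂ app (fun a b c d h => by simpa using h) _
    · exact finite_family (fun t => app t (last t)) (fun a b h => by simpa using h) _
  have hl : (logSet hΔ).Finite := by
    refine ((Set.Finite.union ?_ ?_).union ?_).union ?_
    · exact finite_family (app .ident) (fun a b h => by simpa using h) _
    · exact finite_family (app .bot) (fun a b h => by simpa using h) _
    · refine (finite_family₂ (fun (p : BasicTerm × BasicTerm) α => app (.comp p.1 p.2) α)
        (fun a b c d h => by simpa [Prod.ext_iff] using h) fun p α h =>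
          eq ⟨app (.comp p.1 p.2) α, h⟩ ⟨app p.1 (app p.2 α), hΔ.comp h⟩).subset ?_
      rintro χ ⟨t, u, α, h, rfl⟩
      exact ⟨(t, u), α, h, rfl⟩
    · exact finite_family₂ (fun t u => app (.comp t u) (last (.comp t u)))
        (fun a b c d h => by simpa using h) _
  have hb : (boundsSet hΔ).Finite := by
    refine ((Set.Finite.union ?_ ?_).union ?_).union ?_
    · exact finite_family₂ (fun t α => app (.o t) α) (fun a b c d h => by simpa using h) _
    · exact finite_family₂ (fun t α => app (.o t) α) (fun a b c d h => by simpa using h) _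
    · exact finite_family (fun t => last (.o t)) (fun a b h => by simpa using h) _
    · have := finite_family₂ (Δ := Δ) app (fun a b c d h => by simpa using h) fun t α h =>
        {χ : tau.Formula Δ | ∃ k : app (.o t) (last (.o t)) ∈ Δ,
          χ = ((O ⟨app (.o t) (last (.o t)), k⟩).not ⊓ (O ⟨α, hΔ.arg h⟩).not).imp
            (O ⟨app t α, h⟩).not}
      refine (this.sUnion ?_).subset ?_
      · rintro s ⟨t, α, h, rfl⟩
        by_cases k : app (.o t) (last (.o t)) ∈ Δ
        · refine (Set.finite_singleton (((O ⟨app (.o t) (last (.o t)), k⟩).not ⊓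
            (O ⟨α, hΔ.arg h⟩).not).imp (O ⟨app t α, h⟩).not)).subset ?_
          rintro χ ⟨_, rfl⟩
          rfl
        · refine Set.finite_empty.subset ?_
          rintro χ ⟨k', _⟩
          exact k k'
      · rintro χ ⟨t, α, h, k, rfl⟩
        exact ⟨_, ⟨t, α, h, rfl⟩, k, rfl⟩
  have hr : (rightSet hΔ).Finite := by
    refine ((Set.Finite.union ?_ ?_).union ?_).union ?_
    · exact finite_family₂ (fun t α => app t (app (.r t) α)) (fun a b c d h => by simp_all) _
    · exact finite_family₂ (fun t α => app t (suc (app (.r t) α)))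
        (fun a b c d h => by simp_all) _
    · exact finite_family (fun t => app (.r t) (last (.r t))) (fun a b h => by simpa using h) _
    · exact finite_family (fun t => app t (suc (app (.r t) (last (.r t)))))
        (fun a b h => by simpa using h) _
  have hL : (leftSet hΔ).Finite := by
    refine (((Set.Finite.union ?_ ?_).union ?_).union ?_).union ?_
    · exact finite_family₂ (fun t α => app t (app (.l t) α)) (fun a b c d h => by simp_all) _
    · exact finite_family₂ (fun t α => app t (pre (app (.l t) α)))
        (fun a b c d h => by simp_all) _
    · exact finite_family₂ (fun t α => app t (app (.l t) α)) (fun a b c d h => by simp_all) _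
    · exact finite_family (fun t => app (.l t) (last (.l t))) (fun a b h => by simpa using h) _
    · exact finite_family (fun t => app (.l t) (last (.l t))) (fun a b h => by simpa using h) _
  have hf : (failSet hΔ κ ts).Finite := by
    refine (finite_family (fun t => app t (tvar κ)) (fun a b h => by simpa using h) fun t h =>
      lt ⟨app t (tvar κ), h⟩ ⟨tvar κ, hΔ.arg h⟩).subset ?_
    rintro χ ⟨t, _, h, rfl⟩
    exact ⟨t, h, rfl⟩
  exact ((((hs.union hl).union hb).union hr).union hL).union hf

end Sample

/-- The quantifier-free `τ`-formula `ψ`, with the samples in `Δ` as variables: the conjunction of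
the finite set `psiSet`. -/
noncomputable def psi (κ : ℕ) (ts : List BasicTerm) :
    tau.Formula (Sample.diagramDomain κ ts) :=
  have : Finite (Sample.psiSet (Sample.saturated_saturation _) κ ts :
      Set (tau.Formula (Sample.diagramDomain κ ts))) :=
    (Sample.psiSet_finite _ κ ts).to_subtype
  FirstOrder.Language.Formula.iInf
    fun χ : (Sample.psiSet (Sample.saturated_saturation _) κ ts :
      Set (tau.Formula (Sample.diagramDomain κ ts))) => χ.1

/-- The `σ`-formula `φ = ψ'`. -/
noncomputable def phi (κ : ℕ) (ts : List BasicTerm) :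
    sigma.Formula (Sample.diagramDomain κ ts) := tauToSigma (psi κ ts)

/-! ## Effectivity -/

/-- The bijection `ι : ℕ → ω ∪ {ω}`, `0 ↦ ω`, `n + 1 ↦ n`. -/
def iota : ℕ → ℕ∞
  | 0 => ⊤
  | n + 1 => (n : ℕ∞)

/-- The program `c` is an algorithmic description of the time warp `f`: it halts on every input and
computes `f`, elements of `ω ∪ {ω}` being represented by natural numbers through `ι`. -/
def Describes (c : Nat.Partrec.Code) (f : TimeWarp) : Prop :=
  ∀ m : ℕ, ∃ k ∈ c.eval m, iota k = f (iota m)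

/-- Gödel numbers of basic terms. -/
def BasicTerm.code : BasicTerm → ℕ
  | var x => Nat.pair 0 x
  | comp t u => Nat.pair 1 (Nat.pair t.code u.code)
  | o t => Nat.pair 2 t.code
  | l t => Nat.pair 3 t.code
  | r t => Nat.pair 4 t.code
  | ident => Nat.pair 5 0
  | bot => Nat.pair 6 0

/-- Gödel numbers of samples. -/
def Sample.code : Sample → ℕ
  | tvar κ => Nat.pair 0 κ
  | app t α => Nat.pair 1 (Nat.pair t.code α.code)
  | suc α => Nat.pair 2 α.code
  | pre α => Nat.pair 3 α.code
  | last t => Nat.pair 4 t.code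

/-- The list `G` enumerates the graph of `w : Δ → ℕ`, i.e. it presents `w` as a finite object. -/
def Enumerates {Δ : Set Sample} (G : List (Sample × ℕ)) (w : Δ → ℕ) : Prop :=
  ∀ (α : Sample) (k : ℕ), (α, k) ∈ G ↔ ∃ h : α ∈ Δ, w ⟨α, h⟩ = k

/-- The Gödel number version of a finite list of assignments. -/
def codeGraph (G : List (Sample × ℕ)) : List (ℕ × ℕ) := G.map fun e => (e.1.code, e.2)

/-! ## Time warps and residuals -/

/-! The equation fails under `θ` exactly when some point `p` of the chain `ω⁺` satisfies `tᵢ(p) < p`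
for every `i`, since a finite join is computed pointwise as a maximum. The theorem says that
finitely many values of the terms involved already decide whether such a failure exists. The samples
name the points and values needed, and `ψ` lists the constraints on them.

From a failure to a solution: read `t[α]`, `s`, `p` as evaluation, `+ 1` and truncated `- 1`, and
`last(t)` as the least point where `t` takes its value at `ω`. All constraints hold under this
reading (`isDiagram_value`).

From a solution to a failure: a solution is a map `δ` into `ω⁺` that assigns to each basic term the
partial function `δ(α) ↦ δ(t[α])`. For each variable this partial function is extended to a time
warp (`extends_warpExtension`), and induction on terms shows that the interpreted terms extend their
partial functions (`extends_eval`). Residuals cause no trouble at finite nonzero points because two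
values of `f` certify one value of the residual: `q = (f \ id)(p)` is finite when `f(q) ≤ p < f(q +
1)`, and `q = (id / f)(p)` is finite when `f(q - 1) < p ≤ f(q)`. These arguments are among the
samples by saturation.

The point `ω` is different, because a value there is a limit. If `last(t)` is finite, the limit is
attained at a finite point. If `last(t) = ω`, the term must be proper: it reaches `ω`, but only at
`ω`. Composition and both residuals into `id` preserve and reflect properness (`proper_comp_iff`,
`proper_ldiv_id_iff`, `proper_rdiv_id_iff`). Reflection makes the `last` conjuncts sound;
preservation carries the induction.

The passage from `τ` to `σ` transports `ω⁺` to `ℕ` along `ι`. The extension of a variable is a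
maximum over the finite graph of `w`, hence primitive recursive in that graph, the variable and the
argument. -/

namespace TimeWarp

/-- A monotone function that fixes `0` and is continuous at `ω` is a time warp. -/
def ofMonotone (F : ℕ∞ → ℕ∞) (hF : Monotone F) (h0 : F 0 = 0)
    (htop : ∀ c, (∀ n : ℕ, F n ≤ c) → F ⊤ ≤ c) : TimeWarp where
  toFun := F
  map_sSup' S := by
    apply le_antisymm
    · rcases eq_or_ne (sSup S) ⊤ with h | h
      · rw [h]
        refine htop _ fun n => ?_
        obtain ⟨s, hs, hn⟩ := lt_sSup_iff.1 (h ▸ ENat.natCast_lt_top n : (n : ℕ∞) < sSup S)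
        exact (hF hn.le).trans (le_sSup (Set.mem_image_of_mem F hs))
      · rcases S.eq_empty_or_nonempty with rfl | hne
        · simp [h0]
        · have := hne.to_subtype
          exact le_sSup (Set.mem_image_of_mem F
            (ENat.sSup_mem_of_nonempty_of_lt_top (lt_top_iff_ne_top.2 h)))
    · refine sSup_le ?_
      rintro _ ⟨s, hs, rfl⟩
      exact hF (le_sSup hs)

theorem map_zero (f : TimeWarp) : f 0 = 0 := map_bot f

theorem map_top_le_iff (f : TimeWarp) (c : ℕ∞) : f ⊤ ≤ c ↔ ∀ n : ℕ, f n ≤ c := by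
  rw [← ENat.iSup_natCast, map_iSup, iSup_le_iff]

theorem map_top_eq_top_iff (f : TimeWarp) : f ⊤ = ⊤ ↔ ∀ m : ℕ, ∃ n : ℕ, (m : ℕ∞) < f n := by
  constructor
  · intro h m
    by_contra! hc
    exact absurd ((map_top_le_iff f m).2 hc) (by simp [h])
  · intro h
    refine ENat.eq_top_iff_forall_gt.2 fun m => ?_
    obtain ⟨n, hn⟩ := h m
    exact hn.trans_le (monotone f le_top)

/-- `f ω` is the supremum of the values `f n`, and a natural number `k + 1` cannot lie below a
supremum of values that are all at most `k`. -/
theorem exists_nat_le_map (f : TimeWarp) {m : ℕ} (h : (m : ℕ∞) ≤ f ⊤) :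
    ∃ n : ℕ, (m : ℕ∞) ≤ f n := by
  rcases m.eq_zero_or_pos with rfl | hm
  · exact ⟨0, by simp⟩
  · by_contra! hc
    obtain ⟨k, rfl⟩ : ∃ k, m = k + 1 := ⟨m - 1, by omega⟩
    have : f ⊤ ≤ k := (map_top_le_iff f k).2 fun n => by
      have := hc n
      push_cast at this
      exact Order.lt_add_one_iff_of_not_isMax (by simp) |>.1 this
    have := h.trans this
    norm_cast at this
    omega

theorem exists_nat_map_eq_map_top (f : TimeWarp) (h : f ⊤ ≠ ⊤) : ∃ n : ℕ, f n = f ⊤ := by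
  obtain ⟨m, hm⟩ := ENat.ne_top_iff_exists.1 h
  obtain ⟨n, hn⟩ := exists_nat_le_map f hm.le
  exact ⟨n, le_antisymm (monotone f le_top) (hm ▸ hn)⟩

/-- The time warp that is `q` on `[p, ω]` and `0` below `p`. -/
noncomputable def step (p : ℕ) (hp : p ≠ 0) (q : ℕ∞) : TimeWarp :=
  open Classical in
  ofMonotone (fun x => if (p : ℕ∞) ≤ x then q else 0)
    (fun x y h => by
      dsimp only
      split_ifs with h1 h2
      · exact le_rfl
      · exact absurd (h1.trans h) h2
      · exact zero_le
      · exact le_rfl)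
    (by simp [hp])
    (fun c hc => by simpa using hc p)

theorem step_of_le {p : ℕ} (hp : p ≠ 0) (q : ℕ∞) {x : ℕ∞} (h : (p : ℕ∞) ≤ x) :
    step p hp q x = q := if_pos h

theorem step_of_not_le {p : ℕ} (hp : p ≠ 0) (q : ℕ∞) {x : ℕ∞} (h : ¬ (p : ℕ∞) ≤ x) :
    step p hp q x = 0 := if_neg h

theorem top_apply {p : ℕ∞} (hp : p ≠ 0) : top p = ⊤ := by
  refine top_unique ?_
  have h1 : ((1 : ℕ) : ℕ∞) ≤ p := by simpa using Order.one_le_iff_ne_zero.2 hp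
  rw [← step_of_le one_ne_zero ⊤ h1]
  exact (le_sup (Set.mem_univ _) : step 1 one_ne_zero ⊤ ≤ top) p

theorem join_apply (f g : TimeWarp) (p : ℕ∞) : join f g p = f p ⊔ g p := by
  change ⨆ h ∈ ({f, g} : Set TimeWarp), (h : TimeWarp) p = _
  rw [iSup_insert, iSup_singleton]

/-! ### Pointwise bounds on residuals, tested against step functions. -/

section Residuals

variable (f : TimeWarp)

theorem map_ldiv_id_le (p : ℕ∞) : f (ldiv f (sSupHom.id ℕ∞) p) ≤ p :=
  (le_ldiv_iff f _ _).1 le_rfl p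

/-- A residual is a supremum of time warps, so a lower bound at `p` needs only one competitor: the
step from `0` to `q` at `p`. Such a step is a time warp only if `p` is finite and nonzero (or `q =
0`), which explains the restriction on `p` here and in `le_rdiv_id`. -/
theorem le_ldiv_id {p : ℕ} (hp : p ≠ 0) {q : ℕ∞} (h : f q ≤ p) :
    q ≤ ldiv f (sSupHom.id ℕ∞) p := by
  have : step p hp q ≤ ldiv f (sSupHom.id ℕ∞) := (le_ldiv_iff _ _ _).2 fun x => by
    change f (step p hp q x) ≤ x
    by_cases hx : (p : ℕ∞) ≤ x
    · rw [step_of_le hp q hx]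
      exact h.trans hx
    · rw [step_of_not_le hp q hx, map_zero]
      exact zero_le
  have := this p
  rwa [step_of_le hp q le_rfl] at this

theorem rdiv_id_map_le (q : ℕ∞) : rdiv (sSupHom.id ℕ∞) f (f q) ≤ q :=
  (le_rdiv_iff _ f _).1 le_rfl q

theorem rdiv_id_le {p q : ℕ∞} (h : p ≤ f q) : rdiv (sSupHom.id ℕ∞) f p ≤ q :=
  (monotone _ h).trans (rdiv_id_map_le f q)

theorem le_rdiv_id {p : ℕ} (hp : p ≠ 0) {m : ℕ∞} (h : ∀ q, (p : ℕ∞) ≤ f q → m ≤ q) :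
    m ≤ rdiv (sSupHom.id ℕ∞) f p := by
  have : step p hp m ≤ rdiv (sSupHom.id ℕ∞) f := (le_rdiv_iff _ _ _).2 fun x => by
    change step p hp m (f x) ≤ x
    by_cases hx : (p : ℕ∞) ≤ f x
    · rw [step_of_le hp m hx]
      exact h x hx
    · rw [step_of_not_le hp m hx]
      exact zero_le
  have := this p
  rwa [step_of_le hp m le_rfl] at this

theorem map_eq_top_of_ldiv_top_ne_zero {p : ℕ∞} (h : ldiv top f p ≠ 0) : f p = ⊤ := by
  have h1 : top (ldiv top f p) ≤ f p := (le_ldiv_iff top (ldiv top f) f).1 le_rfl p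
  rwa [top_apply h, top_le_iff] at h1

/-- False at `ω`: for `f = id` one has `f ω = ω`, while `⊤ \ id` is constantly `0`. -/
theorem ldiv_top_eq_top {p : ℕ} (h : f p = ⊤) : ldiv top f p = ⊤ := by
  have hp : p ≠ 0 := by
    rintro rfl
    rw [Nat.cast_zero, map_zero] at h
    exact absurd h (by simp)
  have : step p hp ⊤ ≤ ldiv top f := (le_ldiv_iff _ _ _).2 fun x => by
    change top (step p hp ⊤ x) ≤ f x
    by_cases hx : (p : ℕ∞) ≤ x
    · exact le_top.trans_eq (top_unique (h ▸ monotone f hx)).symm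
    · rw [step_of_not_le hp ⊤ hx, map_zero]
      exact zero_le
  have := this p
  rwa [step_of_le hp ⊤ le_rfl, top_le_iff] at this

/-- Either `f` hits `ω` at a natural number below `p`, which forces the value `ω`, or the residual
vanishes at all naturals up to `p` and, by continuity, at `p = ω` as well. -/
theorem ldiv_top_eq_zero_or_top (p : ℕ∞) : ldiv top f p = 0 ∨ ldiv top f p = ⊤ := by
  by_cases h : ∃ n : ℕ, (n : ℕ∞) ≤ p ∧ f n = ⊤
  · obtain ⟨n, hn, hf⟩ := h
    exact Or.inr (top_unique (ldiv_top_eq_top f hf ▸ monotone _ hn))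
  · push Not at h
    refine Or.inl ?_
    have hz : ∀ n : ℕ, (n : ℕ∞) ≤ p → ldiv top f n = 0 := fun n hn => by
      by_contra hc
      exact h n hn (map_eq_top_of_ldiv_top_ne_zero f hc)
    induction p using ENat.recTopCoe with
    | top => exact nonpos_iff_eq_zero.1 ((map_top_le_iff _ _).2 fun n => (hz n le_top).le)
    | coe n => exact hz n le_rfl

end Residuals

end TimeWarp

/-! ## Semantics of the formulas -/

open FirstOrder.Language

theorem iota_injective : Function.Injective iota := by
  rintro (_ | m) (_ | n) h
  · rfl
  · exact absurd h.symm (ENat.natCast_ne_top n)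
  · exact absurd h (ENat.natCast_ne_top m)
  · rw [Nat.cast_injective (R := ℕ∞) h]

theorem iota_surjective : Function.Surjective iota := fun p => by
  induction p using ENat.recTopCoe with
  | top => exact ⟨0, rfl⟩
  | coe n => exact ⟨n + 1, rfl⟩

theorem iota_eq_top_iff {m : ℕ} : iota m = ⊤ ↔ m = 0 :=
  ⟨fun h => iota_injective h, fun h => h ▸ rfl⟩

theorem iota_eq_zero_iff {m : ℕ} : iota m = 0 ↔ m = 1 :=
  ⟨fun h => iota_injective h, fun h => h ▸ rfl⟩

/-- The right-hand side is the `σ`-formula that replaces `≼`; `iota_eq_add_one_iff` plays the same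
role for `S`, where `ω + 1 = ω` accounts for the first disjunct. -/
theorem iota_le_iff {m n : ℕ} : iota m ≤ iota n ↔ n = 0 ∨ m ≠ 0 ∧ m ≤ n := by
  rcases m with _ | m <;> rcases n with _ | n <;> simp [iota]

theorem iota_eq_add_one_iff {m n : ℕ} :
    iota n = iota m + 1 ↔ m = 0 ∧ n = 0 ∨ m ≠ 0 ∧ n = m + 1 := by
  rcases m with _ | m <;> rcases n with _ | n <;> simp [iota]
  · exact (ENat.natCast_ne_top (m + 1)).symm
  · norm_cast

/-- The structure of `ω ∪ {ω}` transported to `ℕ` along `ι`. -/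
instance tauNat : tau.Structure ℕ where
  funMap f _ := nomatch f
  RelMap R v := match R, v with
    | .I, v => iota (v 0) = 0
    | .O, v => iota (v 0) = ⊤
    | .le, v => iota (v 0) ≤ iota (v 1)
    | .S, v => iota (v 1) = iota (v 0) + 1

section Realize

variable {V : Type} (w : V → ℕ) (x y : V)

@[simp]
theorem realize_tau_I : (tau.I x).Realize w ↔ iota (w x) = 0 := Iff.rfl
@[simp]
theorem realize_tau_O : (tau.O x).Realize w ↔ iota (w x) = ⊤ := Iff.rfl
@[simp]
theorem realize_tau_S : (tau.S x y).Realize w ↔ iota (w y) = iota (w x) + 1 := Iff.rfl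
@[simp]
theorem realize_tau_le : (tau.le x y).Realize w ↔ iota (w x) ≤ iota (w y) := Iff.rfl

@[simp]
theorem realize_tau_eq : (tau.eq x y).Realize w ↔ iota (w x) = iota (w y) :=
  (Iff.rfl : _ ↔ w x = w y).trans iota_injective.eq_iff.symm

@[simp]
theorem realize_tau_lt : (tau.lt x y).Realize w ↔ iota (w x) < iota (w y) := by
  rw [lt_iff_le_not_ge]
  simp [tau.lt, realize_tau_le]

end Realize

theorem realize_tauTermToSigma {V : Type} (v : V → ℕ) (t : tau.Term V) :
    (tauTermToSigma t).realize v = t.realize v := by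
  cases t with
  | var x => rfl
  | func f _ => exact nomatch f

/-- Both structures live on `ℕ`, so only relation atoms need an argument, and for those the
replacement is the description of `ω⁺` through `ι`. -/
theorem realize_tauToSigma {V : Type} {n : ℕ} (χ : tau.BoundedFormula V n) (v : V → ℕ) :
    ∀ xs : Fin n → ℕ, (tauToSigma χ).Realize v xs ↔ χ.Realize v xs := by
  induction χ with
  | falsum => exact fun xs => Iff.rfl
  | equal s t =>
    intro xs
    change (_ = _) ↔ (_ = _)
    rw [realize_tauTermToSigma, realize_tauTermToSigma]
  | @rel n l R ts =>
    intro xs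
    have hz : (sigmaZero : sigma.Term (V ⊕ Fin n)).realize (Sum.elim v xs) = 0 := rfl
    cases R with
    | I =>
      change (_ = _ + 1) ↔ iota _ = 0
      simp [iota_eq_zero_iff, realize_tauTermToSigma, hz]
    | O =>
      change (_ = _) ↔ iota _ = ⊤
      rw [iota_eq_top_iff, realize_tauTermToSigma, hz]
    | le =>
      change BoundedFormula.Realize (_ ⊔ _) v xs ↔ iota _ ≤ iota _
      rw [BoundedFormula.realize_sup, BoundedFormula.realize_inf, BoundedFormula.realize_not,
        iota_le_iff]
      change (_ = _) ∨ ¬ (_ = _) ∧ _ ≤ _ ↔ _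
      simp [realize_tauTermToSigma, hz]
    | S =>
      change BoundedFormula.Realize (_ ⊔ _) v xs ↔ iota _ = iota _ + 1
      rw [BoundedFormula.realize_sup, BoundedFormula.realize_inf, BoundedFormula.realize_inf,
        BoundedFormula.realize_not, iota_eq_add_one_iff]
      change (_ = _) ∧ (_ = _) ∨ ¬ (_ = _) ∧ (_ = _ + 1) ↔ _
      simp [realize_tauTermToSigma, hz]
  | imp χ₁ χ₂ ih₁ ih₂ => exact fun xs => imp_congr (ih₁ xs) (ih₂ xs)
  | all χ ih => exact fun xs => forall_congr' fun a => ih _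

theorem realize_phi_iff {κ : ℕ} {ts : List BasicTerm} {w : Sample.diagramDomain κ ts → ℕ} :
    (phi κ ts).Realize w ↔
      ∀ χ ∈ Sample.psiSet (Sample.saturated_saturation _) κ ts, χ.Realize w := by
  refine (realize_tauToSigma _ _ _).trans ?_
  have : Finite (Sample.psiSet (Sample.saturated_saturation _) κ ts :
      Set (tau.Formula (Sample.diagramDomain κ ts))) :=
    (Sample.psiSet_finite _ κ ts).to_subtype
  refine (Formula.realize_iInf (M := ℕ)).trans ?_
  exact Subtype.forall

/-! ## Quantifier-freeness -/

theorem FirstOrder.Language.BoundedFormula.IsQF.tauToSigma {V : Type} {n : ℕ}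
    {χ : tau.BoundedFormula V n} (h : χ.IsQF) : (_root_.tauToSigma χ).IsQF := by
  induction h with
  | falsum => exact .falsum
  | of_isAtomic h =>
    cases h with
    | equal s t => exact .of_isAtomic (.equal _ _)
    | rel R ts =>
      cases R with
      | I => exact .of_isAtomic (.rel _ _)
      | O => exact .of_isAtomic (.equal _ _)
      | le =>
        exact .sup (.of_isAtomic (.equal _ _))
          (.inf (.not (.of_isAtomic (.equal _ _))) (.of_isAtomic (.rel _ _)))
      | S =>
        exact .sup (.inf (.of_isAtomic (.equal _ _)) (.of_isAtomic (.equal _ _)))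
          (.inf (.not (.of_isAtomic (.equal _ _))) (.of_isAtomic (.rel _ _)))
  | imp _ _ ih₁ ih₂ => exact ih₁.imp ih₂

theorem FirstOrder.Language.BoundedFormula.IsQF.iInf {L : FirstOrder.Language} {V B : Type}
    {n : ℕ} [Finite B] {f : B → L.BoundedFormula V n} (h : ∀ b, (f b).IsQF) :
    (BoundedFormula.iInf f).IsQF := by
  have : ∀ l : List B, ((l.map f).foldr (· ⊓ ·) ⊤).IsQF := fun l => by
    induction l with
    | nil => exact .top
    | cons a l ih => exact (h a).inf ih
  exact this _

namespace Sample

theorem isQF_of_mem_psiSet {Δ : Set Sample} {hΔ : Saturated Δ} {κ : ℕ} {ts : List BasicTerm}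
    {χ : tau.Formula Δ} (h : χ ∈ psiSet hΔ κ ts) : χ.IsQF := by
  have hI : ∀ x : Δ, (tau.I x).IsQF := fun x => .of_isAtomic (.rel _ _)
  have hO : ∀ x : Δ, (tau.O x).IsQF := fun x => .of_isAtomic (.rel _ _)
  have hS : ∀ x y : Δ, (tau.S x y).IsQF := fun x y => .of_isAtomic (.rel _ _)
  have hle : ∀ x y : Δ, (tau.le x y).IsQF := fun x y => .of_isAtomic (.rel _ _)
  have heq : ∀ x y : Δ, (tau.eq x y).IsQF := fun x y => .of_isAtomic (.equal _ _)
  have hlt : ∀ x y : Δ, (tau.lt x y).IsQF := fun x y => (hle x y).inf (hle y x).not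
  rcases h with ((((h | h) | h) | h) | h) | h
  · rcases h with ((((⟨t, α, β, h, k, rfl⟩ | ⟨t, α, h, rfl⟩) | ⟨α, h, rfl⟩) | ⟨α, h, rfl⟩) |
      ⟨t, α, h, rfl⟩) | ⟨t, h, rfl⟩
    · exact (hle _ _).imp (hle _ _)
    · exact (hI _).imp (hI _)
    · exact (hS _ _).sup ((hI _).inf (hI _))
    · exact hS _ _
    · exact ((hle _ _).imp (heq _ _)).inf ((heq _ _).imp (hle _ _))
    · exact (hO _).imp (hO _)
  · rcases h with ((⟨α, h, rfl⟩ | ⟨α, h, rfl⟩) | ⟨t, u, α, h, rfl⟩) | ⟨t, u, h, rfl⟩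
    · exact heq _ _
    · exact hI _
    · exact heq _ _
    · exact (hO _).imp ((hO _).inf (hO _))
  · rcases h with ((⟨t, α, h, rfl⟩ | ⟨t, α, h, rfl⟩) | ⟨t, h, rfl⟩) | ⟨t, α, h, k, rfl⟩
    · exact (hI _).sup (hO _)
    · exact (hO _).not.imp (((hO _).imp (hO _)).inf ((hO _).imp (hO _)))
    · exact (hO _).not
    · exact ((hO _).not.inf (hO _).not).imp (hO _).not
  · rcases h with ((⟨t, α, h, rfl⟩ | ⟨t, α, h, rfl⟩) | ⟨t, h, rfl⟩) | ⟨t, h, rfl⟩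
    · exact hle _ _
    · exact (((hI _).not.inf (hO _).not).inf (hO _).not).imp (hlt _ _)
    · exact (hO _).imp (hO _)
    · exact (hO _).not.imp (hO _)
  · rcases h with (((⟨t, α, h, rfl⟩ | ⟨t, α, h, rfl⟩) | ⟨t, α, h, rfl⟩) | ⟨t, h, rfl⟩) |
      ⟨t, h, rfl⟩
    · exact (hO _).not.imp (hle _ _)
    · exact (((hI _).not.inf (hO _).not).inf (hO _).not).imp (hlt _ _)
    · exact ((hO _).not.inf (hO _)).imp (hlt _ _)
    · exact (hO _).imp (hO _)
    · exact (hO _).not.imp (hO _)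
  · obtain ⟨t, _, h, rfl⟩ := h
    exact hlt _ _

end Sample

theorem isQF_phi (κ : ℕ) (ts : List BasicTerm) : (phi κ ts).IsQF :=
  have : Finite (Sample.psiSet (Sample.saturated_saturation _) κ ts :
      Set (tau.Formula (Sample.diagramDomain κ ts))) :=
    (Sample.psiSet_finite _ κ ts).to_subtype
  (BoundedFormula.IsQF.iInf fun χ => Sample.isQF_of_mem_psiSet χ.2).tauToSigma

/-! ## Diagrams -/

namespace Sample

/-- `δ : Δ → ω ∪ {ω}` (given by a total function) satisfies all conjuncts of `ψ` but those
expressing failure. -/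
structure IsDiagram (Δ : Set Sample) (δ : Sample → ℕ∞) : Prop where
  mono : ∀ {t α β}, app t α ∈ Δ → app t β ∈ Δ → δ α ≤ δ β → δ (app t α) ≤ δ (app t β)
  app_zero : ∀ {t α}, app t α ∈ Δ → δ α = 0 → δ (app t α) = 0
  pre : ∀ {α}, pre α ∈ Δ → δ α = δ (pre α) + 1 ∨ δ (pre α) = 0 ∧ δ α = 0
  suc : ∀ {α}, suc α ∈ Δ → δ (suc α) = δ α + 1
  last_le : ∀ {t α}, app t α ∈ Δ → (δ (last t) ≤ δ α ↔ δ (app t α) = δ (app t (last t)))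
  app_last : ∀ {t}, app t (last t) ∈ Δ → δ (last t) = ⊤ → δ (app t (last t)) = ⊤
  ident : ∀ {α}, app .ident α ∈ Δ → δ (app .ident α) = δ α
  bot : ∀ {α}, app .bot α ∈ Δ → δ (last .bot) = 0
  comp : ∀ {t u α}, app (.comp t u) α ∈ Δ → δ (app (.comp t u) α) = δ (app t (app u α))
  last_comp : ∀ {t u}, app (.comp t u) (last (.comp t u)) ∈ Δ → δ (last (.comp t u)) = ⊤ →
    δ (last t) = ⊤ ∧ δ (last u) = ⊤
  o_zero_or_top : ∀ {t α}, app (.o t) α ∈ Δ → δ (app (.o t) α) = 0 ∨ δ (app (.o t) α) = ⊤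
  o_iff : ∀ {t α}, app (.o t) α ∈ Δ → δ α ≠ ⊤ → (δ (app (.o t) α) = ⊤ ↔ δ (app t α) = ⊤)
  last_o : ∀ {t}, last (.o t) ∈ Δ → δ (last (.o t)) ≠ ⊤
  o_last : ∀ {t α}, app t α ∈ Δ → app (.o t) (last (.o t)) ∈ Δ →
    δ (app (.o t) (last (.o t))) ≠ ⊤ → δ α ≠ ⊤ → δ (app t α) ≠ ⊤
  r_le : ∀ {t α}, app t (app (.r t) α) ∈ Δ → δ (app t (app (.r t) α)) ≤ δ α
  r_lt : ∀ {t α}, app t (.suc (app (.r t) α)) ∈ Δ → δ α ≠ 0 → δ α ≠ ⊤ → δ (app (.r t) α) ≠ ⊤ →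
    δ α < δ (app t (.suc (app (.r t) α)))
  last_r : ∀ {t}, app (.r t) (last (.r t)) ∈ Δ → δ (last (.r t)) = ⊤ → δ (last t) = ⊤
  r_last : ∀ {t}, app t (.suc (app (.r t) (last (.r t)))) ∈ Δ →
    δ (app (.r t) (last (.r t))) ≠ ⊤ → δ (app t (.suc (app (.r t) (last (.r t))))) = ⊤
  l_le : ∀ {t α}, app t (app (.l t) α) ∈ Δ → δ (app (.l t) α) ≠ ⊤ → δ α ≤ δ (app t (app (.l t) α))
  l_pre_lt : ∀ {t α}, app t (.pre (app (.l t) α)) ∈ Δ → δ α ≠ 0 → δ α ≠ ⊤ →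
    δ (app (.l t) α) ≠ ⊤ → δ (app t (.pre (app (.l t) α))) < δ α
  l_lt : ∀ {t α}, app t (app (.l t) α) ∈ Δ → δ α ≠ ⊤ → δ (app (.l t) α) = ⊤ →
    δ (app t (app (.l t) α)) < δ α
  last_l : ∀ {t}, app (.l t) (last (.l t)) ∈ Δ → δ (last (.l t)) = ⊤ → δ (last t) = ⊤
  l_last : ∀ {t}, app (.l t) (last (.l t)) ∈ Δ → δ (app (.l t) (last (.l t))) ≠ ⊤ →
    δ (app t (app (.l t) (last (.l t)))) = ⊤

/-- From here on the syntax is gone: a solution is a diagram with failure at `κ`. Only the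
restriction of `δ` to `Δ` is constrained. -/
theorem realize_psiSet_iff {Δ : Set Sample} (hΔ : Saturated Δ) {κ : ℕ} {ts : List BasicTerm}
    {w : Δ → ℕ} {δ : Sample → ℕ∞} (hδ : ∀ a : Δ, iota (w a) = δ a) :
    (∀ χ ∈ psiSet hΔ κ ts, χ.Realize w) ↔ IsDiagram Δ δ ∧
      ∀ t ∈ ts, app t (tvar κ) ∈ Δ → δ (app t (tvar κ)) < δ (tvar κ) := by
  constructor
  · intro H
    have hs := fun χ h => H χ (.inl (.inl (.inl (.inl (.inl h)))))
    have hg := fun χ h => H χ (.inl (.inl (.inl (.inl (.inr h)))))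
    have hb := fun χ h => H χ (.inl (.inl (.inl (.inr h))))
    have hr := fun χ h => H χ (.inl (.inl (.inr h)))
    have hl := fun χ h => H χ (.inl (.inr h))
    refine ⟨⟨?_, ?_, ?_, ?_, ?_, ?_, ?_, ?_, ?_, ?_, ?_, ?_, ?_, ?_, ?_, ?_, ?_, ?_, ?_, ?_, ?_, ?_,
      ?_⟩, ?_⟩
    · intro t α β h k
      simpa [hδ] using hs _ (.inl (.inl (.inl (.inl (.inl ⟨_, _, _, h, k, rfl⟩)))))
    · intro t α h
      simpa [hδ] using hs _ (.inl (.inl (.inl (.inl (.inr ⟨_, _, h, rfl⟩)))))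
    · intro α h
      simpa [hδ] using hs _ (.inl (.inl (.inl (.inr ⟨_, h, rfl⟩))))
    · intro α h
      simpa [hδ] using hs _ (.inl (.inl (.inr ⟨_, h, rfl⟩)))
    · intro t α h
      simpa [hδ] using hs _ (.inl (.inr ⟨_, _, h, rfl⟩))
    · intro t h
      simpa [hδ] using hs _ (.inr ⟨_, h, rfl⟩)
    · intro α h
      simpa [hδ] using hg _ (.inl (.inl (.inl ⟨_, h, rfl⟩)))
    · intro α h
      simpa [hδ] using hg _ (.inl (.inl (.inr ⟨_, h, rfl⟩)))
    · intro t u α h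
      simpa [hδ] using hg _ (.inl (.inr ⟨_, _, _, h, rfl⟩))
    · intro t u h
      simpa [hδ] using hg _ (.inr ⟨_, _, h, rfl⟩)
    · intro t α h
      simpa [hδ] using hb _ (.inl (.inl (.inl ⟨_, _, h, rfl⟩)))
    · intro t α h
      simpa [hδ] using hb _ (.inl (.inl (.inr ⟨_, _, h, rfl⟩)))
    · intro t h
      simpa [hδ] using hb _ (.inl (.inr ⟨_, h, rfl⟩))
    · intro t α h k
      simpa [hδ] using hb _ (.inr ⟨_, _, h, k, rfl⟩)
    · intro t α h
      simpa [hδ] using hr _ (.inl (.inl (.inl ⟨_, _, h, rfl⟩)))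
    · intro t α h
      simpa [hδ] using hr _ (.inl (.inl (.inr ⟨_, _, h, rfl⟩)))
    · intro t h
      simpa [hδ] using hr _ (.inl (.inr ⟨_, h, rfl⟩))
    · intro t h
      simpa [hδ] using hr _ (.inr ⟨_, h, rfl⟩)
    · intro t α h
      simpa [hδ] using hl _ (.inl (.inl (.inl (.inl ⟨_, _, h, rfl⟩))))
    · intro t α h
      simpa [hδ] using hl _ (.inl (.inl (.inl (.inr ⟨_, _, h, rfl⟩))))
    · intro t α h
      simpa [hδ] using hl _ (.inl (.inl (.inr ⟨_, _, h, rfl⟩)))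
    · intro t h
      simpa [hδ] using hl _ (.inl (.inr ⟨_, h, rfl⟩))
    · intro t h
      simpa [hδ] using hl _ (.inr ⟨_, h, rfl⟩)
    · intro t ht h
      simpa [hδ] using H _ (.inr ⟨t, ht, h, rfl⟩)
  · rintro ⟨D, hf⟩ χ (((((h | h) | h) | h) | h) | h)
    · rcases h with ((((⟨t, α, β, h, k, rfl⟩ | ⟨t, α, h, rfl⟩) | ⟨α, h, rfl⟩) | ⟨α, h, rfl⟩) |
        ⟨t, α, h, rfl⟩) | ⟨t, h, rfl⟩
      · simpa [hδ] using D.mono h k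
      · simpa [hδ] using D.app_zero h
      · simpa [hδ] using D.pre h
      · simpa [hδ] using D.suc h
      · simpa [hδ] using D.last_le h
      · simpa [hδ] using D.app_last h
    · rcases h with ((⟨α, h, rfl⟩ | ⟨α, h, rfl⟩) | ⟨t, u, α, h, rfl⟩) | ⟨t, u, h, rfl⟩
      · simpa [hδ] using D.ident h
      · simpa [hδ] using D.bot h
      · simpa [hδ] using D.comp h
      · simpa [hδ] using D.last_comp h
    · rcases h with ((⟨t, α, h, rfl⟩ | ⟨t, α, h, rfl⟩) | ⟨t, h, rfl⟩) | ⟨t, α, h, k, rfl⟩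
      · simpa [hδ] using D.o_zero_or_top h
      · simpa [hδ] using D.o_iff h
      · simpa [hδ] using D.last_o h
      · simpa [hδ] using D.o_last h k
    · rcases h with ((⟨t, α, h, rfl⟩ | ⟨t, α, h, rfl⟩) | ⟨t, h, rfl⟩) | ⟨t, h, rfl⟩
      · simpa [hδ] using D.r_le h
      · simpa [hδ] using D.r_lt h
      · simpa [hδ] using D.last_r h
      · simpa [hδ] using D.r_last h
    · rcases h with (((⟨t, α, h, rfl⟩ | ⟨t, α, h, rfl⟩) | ⟨t, α, h, rfl⟩) | ⟨t, h, rfl⟩) |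
        ⟨t, h, rfl⟩
      · simpa [hδ] using D.l_le h
      · simpa [hδ] using D.l_pre_lt h
      · simpa [hδ] using D.l_lt h
      · simpa [hδ] using D.last_l h
      · simpa [hδ] using D.l_last h
    · obtain ⟨t, ht, h, rfl⟩ := h
      simpa [hδ] using hf t ht h

end Sample

namespace TimeWarp

/-! ## Time warps that reach `ω` only at `ω` -/

/-- `f` maps `ω`, and no other element, to `ω`. -/
def Proper (f : TimeWarp) : Prop := f ⊤ = ⊤ ∧ ∀ n : ℕ, f n ≠ ⊤

theorem Proper.map_ne_top {f : TimeWarp} (hf : Proper f) {p : ℕ∞} (hp : p ≠ ⊤) : f p ≠ ⊤ := by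
  lift p to ℕ using hp
  exact hf.2 p

/-- For the forward direction: if `g ω` were finite it would be attained at some `n`, and `f ∘ g`
would reach `ω` already there. If `f n = ω`, a `k` with `g k > n` yields the same contradiction. -/
theorem proper_comp_iff (f g : TimeWarp) :
    Proper (sSupHom.comp f g) ↔ Proper f ∧ Proper g := by
  constructor
  · rintro ⟨h1, h2⟩
    change f (g ⊤) = ⊤ at h1
    change ∀ n : ℕ, f (g n) ≠ ⊤ at h2
    have hft : f ⊤ = ⊤ := top_unique (h1.ge.trans (monotone f le_top))
    have hgt : g ⊤ = ⊤ := by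
      by_contra h
      obtain ⟨n, hn⟩ := exists_nat_map_eq_map_top g h
      exact h2 n (hn ▸ h1)
    refine ⟨⟨hft, fun n hn => ?_⟩, hgt, fun n hn => h2 n (hn ▸ hft)⟩
    obtain ⟨k, hk⟩ := (map_top_eq_top_iff g).1 hgt n
    exact h2 k (top_unique (hn ▸ monotone f hk.le))
  · rintro ⟨hf, hg⟩
    refine ⟨?_, fun n => hf.map_ne_top (hg.2 n)⟩
    change f (g ⊤) = ⊤
    rw [hg.1, hf.1]

/-! ### The residual `f \ id` at finite points and at `ω`. -/

theorem ldiv_id_lt_of_lt {f : TimeWarp} {p q : ℕ∞} (h : p < f q) :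
    ldiv f (sSupHom.id ℕ∞) p < q :=
  lt_of_not_ge fun hc => absurd ((monotone f hc).trans (map_ldiv_id_le f p)) (not_le.2 h)

theorem lt_map_ldiv_id_add_one {f : TimeWarp} {p : ℕ∞} (h0 : p ≠ 0) (hp : p ≠ ⊤)
    (h : ldiv f (sSupHom.id ℕ∞) p ≠ ⊤) : p < f (ldiv f (sSupHom.id ℕ∞) p + 1) := by
  lift p to ℕ using hp
  by_contra! hc
  have := le_ldiv_id f (by simpa using h0) hc
  exact absurd this (not_le.2 (ENat.lt_add_one_iff h |>.2 le_rfl))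

/-- If `f(r + 1) ≤ k` with `k` finite, where `r` is the value of the residual at `ω`, then the
residual at `k + 1` is at least `r + 1`, against monotonicity. The point `k + 1` is used because it
is nonzero. -/
theorem map_ldiv_id_top_add_one {f : TimeWarp} (h : ldiv f (sSupHom.id ℕ∞) ⊤ ≠ ⊤) :
    f (ldiv f (sSupHom.id ℕ∞) ⊤ + 1) = ⊤ := by
  refine ENat.eq_top_iff_forall_gt.2 fun k => ?_
  by_contra! hc
  have h1 := le_ldiv_id f k.succ_ne_zero (hc.trans (Nat.cast_le.2 k.le_succ))
  have h2 := h1.trans (monotone _ le_top)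
  exact absurd h2 (not_le.2 (ENat.lt_add_one_iff h |>.2 le_rfl))

/-- Adjunction exchanges the two halves of properness. If `f ω = c` is finite, the residual is `ω`
at `c + 1`; if `f n = ω`, it is bounded by `n` at finite points. Conversely `f(m + 1) = c` makes it
exceed `m` at `c + 1`, and the value `ω` at `n` would give `f ω ≤ n`. -/
theorem proper_ldiv_id_iff (f : TimeWarp) : Proper (ldiv f (sSupHom.id ℕ∞)) ↔ Proper f := by
  constructor
  · rintro ⟨h1, h2⟩
    constructor
    · by_contra hc
      lift f ⊤ to ℕ using hc with c hcf
      exact h2 (c + 1) (top_unique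
        (le_ldiv_id f c.succ_ne_zero (hcf ▸ Nat.cast_le.2 c.le_succ)))
    · intro n hn
      refine absurd ((map_top_le_iff (ldiv f (sSupHom.id ℕ∞)) n).2 fun k => ?_) (by simp [h1])
      exact (ldiv_id_lt_of_lt (hn ▸ ENat.natCast_lt_top k)).le
  · rintro ⟨h1, h2⟩
    constructor
    · refine (map_top_eq_top_iff _).2 fun m => ?_
      obtain ⟨c, hc⟩ := ENat.ne_top_iff_exists.1 (h2 (m + 1))
      refine ⟨c + 1, lt_of_lt_of_le (Nat.cast_lt.2 m.lt_succ_self)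
        (le_ldiv_id f c.succ_ne_zero ?_)⟩
      rw [Nat.succ_eq_add_one, ← hc]
      exact Nat.cast_le.2 c.le_succ
    · intro n hn
      have := map_ldiv_id_le f n
      rw [hn, h1] at this
      exact absurd this (by simp)

/-! ### The residual `id / f` at finite points and at `ω`. -/

theorem le_map_rdiv_id {f : TimeWarp} {p : ℕ∞} (h : rdiv (sSupHom.id ℕ∞) f p ≠ ⊤) :
    p ≤ f (rdiv (sSupHom.id ℕ∞) f p) := by
  have hfin : ∀ n : ℕ, rdiv (sSupHom.id ℕ∞) f n ≠ ⊤ → n ≤ f (rdiv (sSupHom.id ℕ∞) f n) := by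
    intro n h
    rcases eq_or_ne n 0 with rfl | h0
    · simp
    · by_contra! hc
      refine absurd (le_rdiv_id f h0 (m := rdiv (sSupHom.id ℕ∞) f n + 1) fun q hq => ?_)
        (not_le.2 (ENat.lt_add_one_iff h |>.2 le_rfl))
      refine Order.add_one_le_of_lt (lt_of_not_ge fun hle => ?_)
      exact absurd (hq.trans (monotone f hle)) (not_le.2 hc)
  induction p using ENat.recTopCoe with
  | coe n => exact hfin n h
  | top =>
    refine (ENat.eq_top_iff_forall_ge.2 fun n => ?_).ge
    have hle := monotone (rdiv (sSupHom.id ℕ∞) f) (le_top (a := (n : ℕ∞)))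
    exact (hfin n (ne_top_of_le_ne_top h hle)).trans (monotone f hle)

/-- Minimality of `r = (id / f)(p)`. Truncated subtraction is harmless, since `r = 0` would give `p
≤ f 0 = 0`. -/
theorem map_pred_rdiv_id_lt {f : TimeWarp} {p : ℕ∞} (h0 : p ≠ 0)
    (h : rdiv (sSupHom.id ℕ∞) f p ≠ ⊤) : f (rdiv (sSupHom.id ℕ∞) f p - 1) < p := by
  by_contra! hc
  have h1 := rdiv_id_le f hc
  have h2 := le_map_rdiv_id h
  lift rdiv (sSupHom.id ℕ∞) f p to ℕ using h with k
  rcases k.eq_zero_or_pos with rfl | hk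
  · rw [Nat.cast_zero, map_zero] at h2
    exact h0 (nonpos_iff_eq_zero.1 h2)
  · norm_cast at h1
    omega

theorem map_top_lt_of_rdiv_id_eq_top {f : TimeWarp} {p : ℕ∞} (hp : p ≠ ⊤)
    (h : rdiv (sSupHom.id ℕ∞) f p = ⊤) : f ⊤ < p := by
  lift p to ℕ using hp
  by_contra! hc
  obtain ⟨k, hk⟩ := exists_nat_le_map f hc
  have := rdiv_id_le f hk
  rw [h] at this
  exact absurd this (by simp)

theorem rdiv_id_eq_top {f : TimeWarp} {p : ℕ} (h : f ⊤ < p) : rdiv (sSupHom.id ℕ∞) f p = ⊤ := by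
  have hp : p ≠ 0 := by
    rintro rfl
    simp at h
  exact top_unique (le_rdiv_id f hp fun q hq =>
    absurd (hq.trans (monotone f le_top)) (not_le.2 h))

/-- If `f ω = c` is finite, no point reaches `c + 1`, where the residual is therefore `ω`; if `f n =
ω`, it is bounded by `n`. Conversely `f m = c` means that only points beyond `m` reach `c + 1`, and
the value `ω` at `n` would give `f ω < n`. -/
theorem proper_rdiv_id_iff (f : TimeWarp) : Proper (rdiv (sSupHom.id ℕ∞) f) ↔ Proper f := by
  constructor
  · rintro ⟨h1, h2⟩
    constructor
    · by_contra hc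
      lift f ⊤ to ℕ using hc with c hcf
      exact h2 (c + 1) (rdiv_id_eq_top (hcf ▸ Nat.cast_lt.2 c.lt_succ_self))
    · intro n hn
      refine absurd ((map_top_le_iff (rdiv (sSupHom.id ℕ∞) f) n).2 fun k => ?_) (by simp [h1])
      exact rdiv_id_le f (hn ▸ le_top)
  · rintro ⟨h1, h2⟩
    constructor
    · refine (map_top_eq_top_iff _).2 fun m => ?_
      obtain ⟨c, hc⟩ := ENat.ne_top_iff_exists.1 (h2 m)
      refine ⟨c + 1, lt_of_lt_of_le (Nat.cast_lt.2 m.lt_succ_self)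
        (le_rdiv_id f c.succ_ne_zero fun q hq => ?_)⟩
      refine le_of_not_gt fun hlt => ?_
      have hqm : q ≤ m := by
        rw [Nat.succ_eq_add_one, Nat.cast_add_one] at hlt
        exact (ENat.lt_add_one_iff (ENat.natCast_ne_top m)).1 hlt
      have := hq.trans ((monotone f hqm).trans_eq hc.symm)
      norm_cast at this
      omega
    · intro n hn
      have := map_top_lt_of_rdiv_id_eq_top (ENat.natCast_ne_top n) hn
      rw [h1] at this
      exact absurd this (by simp)

/-! ## The least point at which a time warp attains its last value -/

noncomputable def lastPoint (f : TimeWarp) : ℕ∞ := sInf {p | f p = f ⊤}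

theorem map_lastPoint (f : TimeWarp) : f (lastPoint f) = f ⊤ :=
  csInf_mem (s := {p | f p = f ⊤}) ⟨⊤, rfl⟩

theorem lastPoint_le_iff {f : TimeWarp} {p : ℕ∞} : lastPoint f ≤ p ↔ f p = f ⊤ :=
  ⟨fun h => le_antisymm (monotone f le_top) (map_lastPoint f ▸ monotone f h), fun h => sInf_le h⟩

/-- A finite last value is attained at a finite point, so `lastPoint f = ω` forces `f ω = ω`. This
is how the atom `O(last(t))` comes to express properness. -/
theorem lastPoint_eq_top_iff {f : TimeWarp} : lastPoint f = ⊤ ↔ Proper f := by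
  constructor
  · intro h
    have hn : ∀ n : ℕ, f n ≠ f ⊤ := fun n hn => by
      have := lastPoint_le_iff.2 hn
      rw [h] at this
      exact absurd this (by simp)
    have ht : f ⊤ = ⊤ := by
      by_contra hc
      obtain ⟨n, h⟩ := exists_nat_map_eq_map_top f hc
      exact hn n h
    exact ⟨ht, fun n => ht ▸ hn n⟩
  · intro h
    by_contra hc
    exact h.map_ne_top hc (map_lastPoint f ▸ h.1)

end TimeWarp

/-! ## From valuations to diagrams -/

namespace Sample

open TimeWarp

/-- The value of a sample, for a valuation of the variables and a value of the time variables. -/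
noncomputable def value (θ : ℕ → TimeWarp) (p : ℕ∞) : Sample → ℕ∞
  | tvar _ => p
  | app t α => t.toTerm.eval θ (value θ p α)
  | suc α => value θ p α + 1
  | pre α => value θ p α - 1
  | last t => lastPoint (t.toTerm.eval θ)

/-- Soundness of `ψ`. In `last_o`, a term `tᵒ` takes only the values `0` and `ω`, so if it is
nonzero at `ω` it reaches `ω` at a finite point and is never proper. -/
theorem isDiagram_value (Δ : Set Sample) (θ : ℕ → TimeWarp) (p : ℕ∞) :
    IsDiagram Δ (value θ p) where
  mono _ _ h := monotone _ h
  app_zero {t α} _ h := by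
    change t.toTerm.eval θ (value θ p α) = 0
    rw [h, map_zero]
  pre {α} _ := by
    change value θ p α = value θ p α - 1 + 1 ∨ value θ p α - 1 = 0 ∧ _
    rcases eq_or_ne (value θ p α) 0 with h | h
    · simp [h]
    · exact Or.inl (tsub_add_cancel_of_le (Order.one_le_iff_ne_zero.2 h)).symm
  suc _ := rfl
  last_le {t α} _ := by
    change lastPoint _ ≤ _ ↔ t.toTerm.eval θ _ = t.toTerm.eval θ (lastPoint _)
    rw [map_lastPoint, lastPoint_le_iff]
  app_last {t} _ h := by
    change t.toTerm.eval θ (lastPoint _) = ⊤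
    rw [map_lastPoint]
    exact (lastPoint_eq_top_iff.1 h).1
  ident _ := rfl
  bot _ := nonpos_iff_eq_zero.1 (lastPoint_le_iff.2 rfl)
  comp _ := rfl
  last_comp _ h := by
    have := (proper_comp_iff _ _).1 (lastPoint_eq_top_iff.1 h)
    exact ⟨lastPoint_eq_top_iff.2 this.1, lastPoint_eq_top_iff.2 this.2⟩
  o_zero_or_top _ := ldiv_top_eq_zero_or_top _ _
  o_iff {t α} _ hα := by
    obtain ⟨n, hn⟩ := ENat.ne_top_iff_exists.1 hα
    change ldiv top (t.toTerm.eval θ) (value θ p α) = ⊤ ↔ t.toTerm.eval θ (value θ p α) = ⊤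
    rw [← hn]
    exact ⟨fun h => map_eq_top_of_ldiv_top_ne_zero _ (by simp [h]), ldiv_top_eq_top _⟩
  last_o {t} _ h := by
    obtain ⟨h1, h2⟩ := lastPoint_eq_top_iff.1 h
    obtain ⟨n, hn⟩ := (map_top_eq_top_iff _).1 h1 0
    rcases ldiv_top_eq_zero_or_top (t.toTerm.eval θ) n with h | h
    · exact hn.ne' h
    · exact h2 n h
  o_last {t α} _ _ h hα hc := by
    refine h ((map_lastPoint _).trans (top_unique ?_))
    obtain ⟨n, hn⟩ := ENat.ne_top_iff_exists.1 hα
    change t.toTerm.eval θ (value θ p α) = ⊤ at hc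
    rw [← hn] at hc
    exact (ldiv_top_eq_top _ hc).ge.trans (monotone _ le_top)
  r_le _ := map_ldiv_id_le _ _
  r_lt _ h0 hα h := lt_map_ldiv_id_add_one h0 hα h
  last_r _ h := lastPoint_eq_top_iff.2 ((proper_ldiv_id_iff _).1 (lastPoint_eq_top_iff.1 h))
  r_last {t} _ h := by
    set g := ldiv (t.toTerm.eval θ) (sSupHom.id ℕ∞)
    change g (lastPoint g) ≠ ⊤ at h
    change t.toTerm.eval θ (g (lastPoint g) + 1) = ⊤
    rw [map_lastPoint] at h ⊢
    exact map_ldiv_id_top_add_one h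
  l_le _ h := le_map_rdiv_id h
  l_pre_lt _ h0 _ h := map_pred_rdiv_id_lt h0 h
  l_lt {t α} _ hα h := by
    change t.toTerm.eval θ (value θ p (app (.l t) α)) < _
    rw [h]
    exact map_top_lt_of_rdiv_id_eq_top hα h
  last_l _ h := lastPoint_eq_top_iff.2 ((proper_rdiv_id_iff _).1 (lastPoint_eq_top_iff.1 h))
  l_last {t} _ h := by
    set g := rdiv (sSupHom.id ℕ∞) (t.toTerm.eval θ)
    change g (lastPoint g) ≠ ⊤ at h
    change t.toTerm.eval θ (g (lastPoint g)) = ⊤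
    rw [map_lastPoint] at h ⊢
    exact top_unique (le_map_rdiv_id h)

end Sample

/-! ### Failure of the equation at a point. -/

theorem le_eval_joinTerm_iff (θ : ℕ → TimeWarp) (c p : ℕ∞) :
    ∀ ts : List BasicTerm, ts ≠ [] →
      (c ≤ (joinTerm ts).eval θ p ↔ ∃ t ∈ ts, c ≤ t.toTerm.eval θ p)
  | [], h => absurd rfl h
  | [t], _ => by simp [joinTerm]
  | t :: u :: ts, _ => by
    have ih := le_eval_joinTerm_iff θ c p (u :: ts) (by simp)
    change c ≤ TimeWarp.join _ _ p ↔ _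
    rw [TimeWarp.join_apply, le_sup_iff, ih]
    simp

theorem not_holds_idLeJoin_iff (θ : ℕ → TimeWarp) {ts : List BasicTerm} (hts : ts ≠ []) :
    ¬ (idLeJoin ts).Holds θ ↔ ∃ p : ℕ∞, ∀ t ∈ ts, t.toTerm.eval θ p < p := by
  have : (idLeJoin ts).Holds θ ↔ ∀ p : ℕ∞, p ≤ (joinTerm ts).eval θ p :=
    ⟨fun h p => inf_eq_left.1 (DFunLike.congr_fun h p),
      fun h => DFunLike.ext _ _ fun p => inf_eq_left.2 (h p)⟩
  simp only [this, le_eval_joinTerm_iff θ _ _ ts hts]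
  push Not
  rfl

theorem exists_realize_phi {κ : ℕ} {ts : List BasicTerm} (hts : ts ≠ []) {θ : ℕ → TimeWarp}
    (h : ¬ (idLeJoin ts).Holds θ) :
    ∃ w : Sample.diagramDomain κ ts → ℕ, (phi κ ts).Realize w := by
  obtain ⟨p, hp⟩ := (not_holds_idLeJoin_iff θ hts).1 h
  refine ⟨fun a => Function.surjInv iota_surjective (Sample.value θ p a),
    realize_phi_iff.2 ((Sample.realize_psiSet_iff _ fun a =>
      Function.surjInv_eq iota_surjective _).2 ⟨Sample.isDiagram_value _ θ p, fun t ht _ => ?_⟩)⟩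
  exact hp t ht

/-! ## From diagrams to valuations -/

namespace Sample

open TimeWarp

/-- The time warp `f` extends the partial function on `ω ∪ {ω}` that `δ` associates with `t`,
and attains its value at `ω` only at `ω` whenever `δ` says so. -/
structure Extends (Δ : Set Sample) (δ : Sample → ℕ∞) (t : BasicTerm) (f : TimeWarp) : Prop where
  map_eq : ∀ {α}, app t α ∈ Δ → f (δ α) = δ (app t α)
  proper : app t (last t) ∈ Δ → δ (last t) = ⊤ → Proper f

section

variable {Δ : Set Sample} {δ : Sample → ℕ∞} {t u : BasicTerm} {f g : TimeWarp}

/-- To extend a diagram it suffices to do so at the finite points, to be proper if required, and to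
be bounded by a finite last value. -/
theorem Extends.of_finite (hΔ : Saturated Δ) (D : IsDiagram Δ δ)
    (hfin : ∀ {α}, app t α ∈ Δ → δ α ≠ ⊤ → f (δ α) = δ (app t α))
    (hp : app t (last t) ∈ Δ → δ (last t) = ⊤ → Proper f)
    (htop : ∀ {α}, app t α ∈ Δ → δ α = ⊤ → app t (last t) ∈ Δ → δ (last t) ≠ ⊤ →
      δ (app t (last t)) ≠ ⊤ → f ⊤ ≤ δ (app t (last t))) : Extends Δ δ t f := by
  refine ⟨fun {α} hα => ?_, hp⟩
  by_cases h : δ α = ⊤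
  · have hl := hΔ.appLast hα
    -- A sample at `ω` lies beyond `last(t)`, so all such samples share the value of `t[last(t)]`,
    -- and one value at `ω` must be matched.
    rw [(D.last_le hα).1 (h ▸ le_top), h]
    by_cases hlt : δ (last t) = ⊤
    · rw [D.app_last hl hlt]
      exact (hp hl hlt).1
    · refine le_antisymm ?_ (hfin hl hlt ▸ monotone f le_top)
      by_cases hv : δ (app t (last t)) = ⊤
      · exact le_top.trans_eq hv.symm
      · exact htop hα h hl hlt hv
  · exact hfin hα h

theorem Extends.ident (D : IsDiagram Δ δ) : Extends Δ δ .ident (sSupHom.id ℕ∞) :=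
  ⟨fun h => (D.ident h).symm, fun _ _ => ⟨rfl, fun n => ENat.natCast_ne_top n⟩⟩

theorem Extends.bot (hΔ : Saturated Δ) (D : IsDiagram Δ δ) : Extends Δ δ .bot ⊥ := by
  refine ⟨fun {α} h => ?_, fun h h' => absurd (D.bot h) (by simp [h'])⟩
  have hl := D.bot h
  rw [(D.last_le h).1 (by simp [hl]), D.app_zero (hΔ.appLast h) hl]
  rfl

theorem Extends.comp (hΔ : Saturated Δ) (D : IsDiagram Δ δ) (hf : Extends Δ δ t f)
    (hg : Extends Δ δ u g) : Extends Δ δ (.comp t u) (sSupHom.comp f g) := by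
  refine ⟨fun {α} h => ?_, fun h h' => ?_⟩
  · have h1 := hΔ.comp h
    change f (g (δ α)) = _
    rw [D.comp h, hg.map_eq (hΔ.arg h1), hf.map_eq h1]
  · have h1 := hΔ.comp h
    have hl := D.last_comp h h'
    exact (proper_comp_iff f g).2
      ⟨hf.proper (hΔ.appLast h1) hl.1, hg.proper (hΔ.appLast (hΔ.arg h1)) hl.2⟩

theorem Extends.o (hΔ : Saturated Δ) (D : IsDiagram Δ δ) (hf : Extends Δ δ t f) :
    Extends Δ δ (.o t) (ldiv top f) := by
  refine .of_finite hΔ D (fun {α} h hα => ?_) (fun h h' => absurd h' (D.last_o (hΔ.arg h)))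
    fun {α} hα hαt h _ hv => ?_
  · have hfα := hf.map_eq (hΔ.o h)
    obtain ⟨n, hn⟩ := ENat.ne_top_iff_exists.1 hα
    rcases D.o_zero_or_top h with h0 | ht
    · rw [h0]
      by_contra hc
      have := map_eq_top_of_ldiv_top_ne_zero f hc
      rw [hfα, ← D.o_iff h hα, h0] at this
      exact absurd this (by simp)
    · rw [ht, ← hn]
      refine ldiv_top_eq_top f ?_
      rw [hn, hfα, ← D.o_iff h hα, ht]
  -- The residual vanishes at every natural `n`, for otherwise `f n = ω`. That contradicts
  -- properness if `last(t)` is `ω`; if it is finite, then `t[last(t)] = ω`, which `o_last`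
  -- excludes.
  · refine (map_top_le_iff _ _).2 fun n => le_of_eq_of_le ?_ zero_le
    by_contra hc
    have hn := map_eq_top_of_ldiv_top_ne_zero f hc
    have hl := hΔ.appLast (hΔ.o h)
    by_cases hlt : δ (last t) = ⊤
    · exact (hf.proper hl hlt).2 n hn
    · refine D.o_last hl h hv hlt ?_
      rw [← (D.last_le (hΔ.o hα)).1 (hαt ▸ le_top), ← hf.map_eq (hΔ.o hα), hαt]
      exact top_unique (hn.ge.trans (monotone f le_top))

/-- At a finite nonzero point `p` the samples `t[tʳ[α]]` and `t[s(tʳ[α])]` give `f q ≤ p < f(q + 1)`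
for finite `q = δ(tʳ[α])`; for `q = ω` the first inequality suffices. A finite last value bounds the
residual at `ω` because `f` is `ω` at its successor. -/
theorem Extends.r (hΔ : Saturated Δ) (D : IsDiagram Δ δ) (hf : Extends Δ δ t f) :
    Extends Δ δ (.r t) (ldiv f (sSupHom.id ℕ∞)) := by
  refine .of_finite hΔ D (fun {α} h hα => ?_)
    (fun h h' => (proper_ldiv_id_iff f).2 (hf.proper (hΔ.appLast (hΔ.r h)) (D.last_r h h')))
    fun _ _ h _ hv => ?_
  · have h1 := hΔ.r h
    have h2 : app t (.suc (app (.r t) α)) ∈ Δ := hΔ h (.rSuc t α)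
    by_cases h0 : δ α = 0
    · rw [D.app_zero h h0, h0, map_zero]
    have hle := D.r_le h1
    rw [← hf.map_eq h1] at hle
    have hlt := D.r_lt h2 h0 hα
    rw [← hf.map_eq h2, D.suc (hΔ.arg h2)] at hlt
    refine le_antisymm ?_ ?_
    · by_cases ht : δ (app (.r t) α) = ⊤
      · exact ht ▸ le_top
      · exact (ENat.lt_add_one_iff ht).1 (ldiv_id_lt_of_lt (hlt ht))
    · obtain ⟨n, hn⟩ := ENat.ne_top_iff_exists.1 hα
      rw [← hn] at hle h0 ⊢
      exact le_ldiv_id f (by simpa using h0) hle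
  · have h2 : app t (.suc (app (.r t) (last (.r t)))) ∈ Δ := hΔ h (.rSuc t _)
    have hv' := D.r_last h2 hv
    rw [← hf.map_eq h2, D.suc (hΔ.arg h2)] at hv'
    exact (map_top_le_iff _ _).2 fun n => (ENat.lt_add_one_iff hv).1
      (ldiv_id_lt_of_lt (hv' ▸ ENat.natCast_lt_top n))

/-- At a finite nonzero point `p`, a finite `q = δ(tˡ[α])` is certified by `f(q - 1) < p ≤ f q`, and
`q = ω` by `f ω < p`. -/
theorem Extends.l (hΔ : Saturated Δ) (D : IsDiagram Δ δ) (hf : Extends Δ δ t f) :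
    Extends Δ δ (.l t) (rdiv (sSupHom.id ℕ∞) f) := by
  refine .of_finite hΔ D (fun {α} h hα => ?_)
    (fun h h' => (proper_rdiv_id_iff f).2 (hf.proper (hΔ.appLast (hΔ.l h)) (D.last_l h h')))
    fun _ _ h _ hv => ?_
  · have h1 := hΔ.l h
    have h2 : app t (.pre (app (.l t) α)) ∈ Δ := hΔ h (.lPre t α)
    by_cases h0 : δ α = 0
    · rw [D.app_zero h h0, h0, map_zero]
    by_cases ht : δ (app (.l t) α) = ⊤
    · have hlt := D.l_lt h1 hα ht
      obtain ⟨n, hn⟩ := ENat.ne_top_iff_exists.1 hα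
      rw [← hf.map_eq h1, ht, ← hn] at hlt
      rw [ht, ← hn, rdiv_id_eq_top hlt]
    · have hle := D.l_le h1 ht
      rw [← hf.map_eq h1] at hle
      have hlt := D.l_pre_lt h2 h0 hα ht
      rw [← hf.map_eq h2] at hlt
      refine le_antisymm (rdiv_id_le f hle) ?_
      obtain ⟨n, hn⟩ := ENat.ne_top_iff_exists.1 hα
      rw [← hn] at hlt h0 ⊢
      refine le_rdiv_id f (by simpa using h0) fun q hq => ?_
      -- Every `q` that reaches the point lies strictly beyond the predecessor of the prescribed
      -- value, hence is at least that value.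
      have hpq : δ (.pre (app (.l t) α)) < q :=
        lt_of_not_ge fun hc => absurd (hq.trans (monotone f hc)) (not_le.2 hlt)
      rcases D.pre (hΔ.arg h2) with hp | ⟨-, hp⟩
      · rw [hp]
        exact Order.add_one_le_of_lt hpq
      · rw [hp]
        exact zero_le
  · have h1 := hΔ.l h
    have hv' := D.l_last h hv
    rw [← hf.map_eq h1] at hv'
    exact rdiv_id_le f hv'.ge

theorem extends_eval (hΔ : Saturated Δ) (D : IsDiagram Δ δ) {θ : ℕ → TimeWarp}
    (hθ : ∀ x, Extends Δ δ (.var x) (θ x)) (t : BasicTerm) :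
    Extends Δ δ t (t.toTerm.eval θ) := by
  induction t with
  | var x => exact hθ x
  | comp t u iht ihu => exact .comp hΔ D iht ihu
  | o t ih => exact .o hΔ D ih
  | l t ih => exact .l hΔ D ih
  | r t ih => exact .r hΔ D ih
  | ident => exact .ident D
  | bot => exact .bot hΔ D

end

/-! ### Extending the values of a variable -/

section Warp

variable (Δ : Set Sample) (δ : Sample → ℕ∞) (N : ℕ) (x : ℕ)

/-- The step function through the points prescribed by `δ` for the variable `x`, with a copy of the
identity added beyond `N` if the last value is to be attained at `ω` only. -/
noncomputable def stepExtension (p : ℕ∞) : ℕ∞ :=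
  (⨆ (α : Sample) (_ : app (.var x) α ∈ Δ) (_ : δ α ≤ p), δ (app (.var x) α)) ⊔
    ⨆ (_ : last (.var x) ∈ Δ) (_ : δ (last (.var x)) = ⊤), p - N

/-- Upper bounds determine the value and avoid suprema over samples. The program is characterised in
the same form in `iota_extensionValue_le_iff`, so the two can be matched clause by clause. -/
theorem stepExtension_le_iff {p c : ℕ∞} : stepExtension Δ δ N x p ≤ c ↔
    (∀ α, app (.var x) α ∈ Δ → δ α ≤ p → δ (app (.var x) α) ≤ c) ∧
      (last (.var x) ∈ Δ → δ (last (.var x)) = ⊤ → p - N ≤ c) := by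
  simp only [stepExtension, sup_le_iff, iSup_le_iff]

variable {Δ δ N x}

theorem le_stepExtension {α : Sample} {p : ℕ∞} (h : app (.var x) α ∈ Δ) (hp : δ α ≤ p) :
    δ (app (.var x) α) ≤ stepExtension Δ δ N x p :=
  ((stepExtension_le_iff Δ δ N x).1 le_rfl).1 α h hp

theorem sub_le_stepExtension {p : ℕ∞} (h : last (.var x) ∈ Δ) (hl : δ (last (.var x)) = ⊤) :
    p - N ≤ stepExtension Δ δ N x p :=
  ((stepExtension_le_iff Δ δ N x).1 le_rfl).2 h hl

theorem stepExtension_mono : Monotone (stepExtension Δ δ N x) := fun _ _ h =>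
  (stepExtension_le_iff Δ δ N x).2 ⟨fun _ hα hp => le_stepExtension hα (hp.trans h),
    fun hl ht => (tsub_le_tsub_right h _).trans (sub_le_stepExtension hl ht)⟩

theorem top_le_of_forall_sub_le {c : ℕ∞} (h : ∀ n : ℕ, (n : ℕ∞) - N ≤ c) : ⊤ ≤ c := by
  refine (ENat.eq_top_iff_forall_ge.2 fun n => ?_).ge
  simpa using h (n + N)

/-- The time warp with graph `stepExtension`. -/
noncomputable def warpExtension (hΔ : Saturated Δ) (D : IsDiagram Δ δ) (N x : ℕ) : TimeWarp :=
  ofMonotone (stepExtension Δ δ N x) stepExtension_mono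
    (nonpos_iff_eq_zero.1 ((stepExtension_le_iff Δ δ N x).2
      ⟨fun _ hα hp => (D.app_zero hα (nonpos_iff_eq_zero.1 hp)).le, fun _ _ => by simp⟩))
    fun c hc => by
      refine (stepExtension_le_iff Δ δ N x).2 ⟨fun α hα _ => ?_, fun hl ht => ?_⟩
      · have hlast := hΔ.appLast hα
        by_cases ht : δ (last (.var x)) = ⊤
        · exact le_top.trans (top_le_of_forall_sub_le fun n =>
            (sub_le_stepExtension (hΔ.arg hlast) ht).trans (hc n))
        · obtain ⟨n, hn⟩ := ENat.ne_top_iff_exists.1 ht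
          refine le_trans ?_ ((le_stepExtension (N := N) hlast hn.ge).trans (hc n))
          rcases le_total (δ (last (.var x))) (δ α) with h | h
          · exact ((D.last_le hα).1 h).le
          · exact D.mono hα hlast h
      · exact le_top.trans (top_le_of_forall_sub_le fun n =>
            (sub_le_stepExtension hl ht).trans (hc n))

/-- `N` bounds all finite values of `δ`, so `p - N` vanishes at the finite prescribed points and
cannot disturb them, yet still tends to `ω`. -/
theorem extends_warpExtension (hΔ : Saturated Δ) (D : IsDiagram Δ δ)
    (hN : ∀ α ∈ Δ, δ α ≠ ⊤ → δ α ≤ N) : Extends Δ δ (.var x) (warpExtension hΔ D N x) := by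
  refine .of_finite hΔ D (fun {α} h hα => ?_) (fun h ht => ⟨?_, fun n => ?_⟩) fun _ _ h hl _ => ?_
  · refine le_antisymm ((stepExtension_le_iff Δ δ N x).2
      ⟨fun β hβ hle => D.mono hβ h hle, fun _ _ => ?_⟩) (le_stepExtension h le_rfl)
    rw [tsub_eq_zero_of_le (hN α (hΔ.arg h) hα)]
    exact zero_le
  · refine top_unique ?_
    exact (D.app_last h ht).ge.trans (le_stepExtension h le_top)
  · refine ne_top_of_le_ne_top (b := ((max N n : ℕ) : ℕ∞)) (ENat.natCast_ne_top _)
      ((stepExtension_le_iff Δ δ N x).2 ⟨fun β hβ hle => ?_, fun _ _ => ?_⟩)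
    -- A prescribed value `ω` at `β` would equal the value at `last(x)`, putting `β` beyond `last(x)
    -- = ω`, although it lies below `n`.
    · refine (hN _ hβ fun hc => ?_).trans (Nat.cast_le.2 (le_max_left N n))
      rw [← D.app_last h ht, ← D.last_le hβ, ht] at hc
      exact absurd (hc.trans hle) (by simp)
    · exact tsub_le_self.trans (Nat.cast_le.2 (le_max_right N n))
  · refine (stepExtension_le_iff Δ δ N x).2 ⟨fun β hβ _ => ?_, fun _ ht => absurd ht hl⟩
    rcases le_total (δ (last (.var x))) (δ β) with h' | h'
    · exact ((D.last_le hβ).1 h').le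
    · exact D.mono hβ h h'

end Warp

end Sample

/-! ## Computing the extensions -/

theorem BasicTerm.code_injective : Function.Injective BasicTerm.code := by
  intro t
  induction t with
  | var x => intro u h; cases u <;> simp_all [BasicTerm.code]
  | comp t₁ t₂ ih₁ ih₂ =>
    intro u h
    cases u <;> simp [BasicTerm.code] at h
    rw [ih₁ h.1, ih₂ h.2]
  | o t ih | l t ih | r t ih =>
    intro u h
    cases u <;> simp [BasicTerm.code] at h
    rw [ih h]
  | ident | bot => intro u h; cases u <;> simp_all [BasicTerm.code]

theorem Sample.code_injective : Function.Injective Sample.code := by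
  intro α
  induction α with
  | tvar κ => intro β h; cases β <;> simp_all [Sample.code]
  | app t α ih =>
    intro β h
    cases β <;> simp [Sample.code] at h
    rw [BasicTerm.code_injective h.1, ih h.2]
  | suc α ih | pre α ih =>
    intro β h
    cases β <;> simp [Sample.code] at h
    rw [ih h]
  | last t =>
    intro β h
    cases β <;> simp [Sample.code] at h
    rw [BasicTerm.code_injective h]

/-- The maximum in `ω ∪ {ω}`, in terms of representatives. -/
def iotaMax (a b : ℕ) : ℕ := if a = 0 then 0 else if b = 0 then 0 else max a b

theorem iota_iotaMax (a b : ℕ) : iota (iotaMax a b) = iota a ⊔ iota b := by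
  rcases a with _ | a <;> rcases b with _ | b <;> simp [iotaMax, iota]
  exact Nat.mono_cast.map_max

/-- The difference of an element of `ω ∪ {ω}` and a natural number, in terms of representatives. -/
def iotaSub (m N : ℕ) : ℕ := if m = 0 then 0 else m - 1 - N + 1

theorem iota_iotaSub (m N : ℕ) : iota (iotaSub m N) = iota m - N := by
  rcases m with _ | m <;> simp [iotaSub, iota]

section Folds

variable {A : Type} (P : A → Prop) [DecidablePred P] (g : A → ℕ)

theorem iota_foldr_iotaMax_le_iff (b : ℕ) (c : ℕ∞) (l : List A) :
    iota (l.foldr (fun e s => if P e then iotaMax (g e) s else s) b) ≤ c ↔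
      iota b ≤ c ∧ ∀ e ∈ l, P e → iota (g e) ≤ c := by
  induction l with
  | nil => simp
  | cons a l ih =>
    rw [List.foldr_cons, List.forall_mem_cons]
    split_ifs with h
    · rw [iota_iotaMax, sup_le_iff, ih]
      tauto
    · rw [ih]
      tauto

end Folds

/-- The order on `ω ∪ {ω}`, in terms of representatives. -/
def IotaLE (a b : ℕ) : Prop := b = 0 ∨ a ≠ 0 ∧ a ≤ b

instance (a b : ℕ) : Decidable (IotaLE a b) := inferInstanceAs (Decidable (_ ∨ _))

/-- The maximum is over representatives: a finite value `k` is represented by `k + 1`, so the result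
still bounds all finite values. -/
def maxValue (G : List (ℕ × ℕ)) : ℕ := G.foldr (fun e s => max e.2 s) 0

theorem maxValue_le_iff {G : List (ℕ × ℕ)} {c : ℕ} : maxValue G ≤ c ↔ ∀ e ∈ G, e.2 ≤ c := by
  induction G with
  | nil => simp [maxValue]
  | cons a l ih =>
    rw [List.forall_mem_cons, ← ih]
    exact max_le_iff

/-- The value at `m` of the time warp that extends the values of the variable `x` listed in `G`. -/
def extensionValue (G : List (ℕ × ℕ)) (x m : ℕ) : ℕ :=
  -- The outer test recognises the code of `last(x)` with value `ω` (represented by `0`). The inner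
  -- fold ranges over pairs of entries, one for `x[β]` and one for `β`, and starts at `1`, which
  -- represents `0`.
  G.foldr (fun e s => if e.1 = Nat.pair 4 (Nat.pair 0 x) ∧ e.2 = 0
      then iotaMax (iotaSub m (maxValue G)) s else s)
    ((G ×ˢ G).foldr (fun e s => if e.1.1 = Nat.pair 1 (Nat.pair (Nat.pair 0 x) e.2.1) ∧
      IotaLE e.2.2 m then iotaMax e.1.2 s else s) 1)

theorem iota_extensionValue_le_iff {G : List (ℕ × ℕ)} {x m : ℕ} {c : ℕ∞} :
    iota (extensionValue G x m) ≤ c ↔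
      (∀ a k b j, (a, k) ∈ G → (b, j) ∈ G → a = Nat.pair 1 (Nat.pair (Nat.pair 0 x) b) →
        iota j ≤ iota m → iota k ≤ c) ∧
      ((Nat.pair 4 (Nat.pair 0 x), 0) ∈ G → iota m - maxValue G ≤ c) := by
  have h1 : iota 1 = 0 := rfl
  rw [extensionValue, iota_foldr_iotaMax_le_iff
    (fun e : ℕ × ℕ => e.1 = Nat.pair 4 (Nat.pair 0 x) ∧ e.2 = 0), iota_foldr_iotaMax_le_iff
    (fun e : (ℕ × ℕ) × (ℕ × ℕ) =>
      e.1.1 = Nat.pair 1 (Nat.pair (Nat.pair 0 x) e.2.1) ∧ IotaLE e.2.2 m)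
    (fun e => e.1.2), iota_iotaSub, h1]
  simp only [zero_le, true_and, Prod.forall, List.mem_product, and_imp, IotaLE,
    ← iota_le_iff]
  refine and_congr ⟨fun h a k b j => h a k b j, fun h a k b j => h a k b j⟩
    ⟨fun h h' => h _ _ h' rfl rfl, ?_⟩
  rintro h a k h' rfl rfl
  exact h h'

/-! ### Primitive recursiveness of the extension. -/

theorem Primrec.iotaMax : Primrec₂ iotaMax :=
  Primrec.ite (Primrec.eq.comp .fst (.const 0)) (.const 0)
    (Primrec.ite (Primrec.eq.comp .snd (.const 0)) (.const 0) Primrec.nat_max)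

theorem Primrec.iotaSub : Primrec₂ iotaSub :=
  Primrec.ite (Primrec.eq.comp .fst (.const 0)) (.const 0)
    (Primrec.succ.comp (Primrec.nat_sub.comp (Primrec.nat_sub.comp .fst (.const 1)) .snd))

theorem PrimrecRel.iotaLE : PrimrecRel IotaLE :=
  (Primrec.eq.comp .snd (.const 0)).or
    ((Primrec.eq.comp .fst (.const 0)).not.and (Primrec.nat_le.comp .fst .snd))

theorem Primrec.maxValue : Primrec maxValue :=
  Primrec.list_foldr .id (.const 0)
    (Primrec.nat_max.comp (Primrec.snd.comp (Primrec.fst.comp .snd))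
      (Primrec.snd.comp .snd)).to₂

theorem Primrec.list_product {A B : Type} [Primcodable A] [Primcodable B] :
    Primrec₂ fun (l : List A) (k : List B) => l ×ˢ k :=
  Primrec.list_flatMap (f := fun p : List A × List B => p.1)
    (g := fun p a => p.2.map (Prod.mk a)) .fst
    (Primrec.list_map (f := fun q : (List A × List B) × A => q.1.2)
      (Primrec.snd.comp .fst) (Primrec.pair (Primrec.snd.comp .fst) .snd).to₂).to₂

theorem Primrec.foldr_iotaMax {A B : Type} [Primcodable A] [Primcodable B] {l : A → List B}
    {b : A → ℕ} {P : A → B → Prop} [∀ a, DecidablePred (P a)] {g : A → B → ℕ} (hl : Primrec l)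
    (hb : Primrec b) (hP : PrimrecRel P) (hg : Primrec₂ g) :
    Primrec fun a => (l a).foldr (fun e s => if P a e then _root_.iotaMax (g a e) s else s) (b a) :=
  Primrec.list_foldr (h := fun a p => if P a p.1 then _root_.iotaMax (g a p.1) p.2 else p.2) hl hb
    (Primrec.ite (hP.comp .fst (Primrec.fst.comp .snd))
      (Primrec.iotaMax.comp (hg.comp .fst (Primrec.fst.comp .snd)) (Primrec.snd.comp .snd))
      (Primrec.snd.comp .snd)).to₂

theorem primrec_extensionValue :
    Primrec fun a : (List (ℕ × ℕ) × ℕ) × ℕ => extensionValue a.1.1 a.1.2 a.2 := by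
  have hG : Primrec fun a : (List (ℕ × ℕ) × ℕ) × ℕ => a.1.1 := .comp .fst .fst
  have hx : Primrec fun a : (List (ℕ × ℕ) × ℕ) × ℕ => Nat.pair 0 a.1.2 :=
    Primrec₂.natPair.comp (.const 0) (.comp .snd .fst)
  refine Primrec.foldr_iotaMax
    (P := fun (a : (List (ℕ × ℕ) × ℕ) × ℕ) e => e.1 = Nat.pair 4 (Nat.pair 0 a.1.2) ∧ e.2 = 0)
    (g := fun a _ => iotaSub a.2 (maxValue a.1.1)) hG
    (Primrec.foldr_iotaMax
      (P := fun (a : (List (ℕ × ℕ) × ℕ) × ℕ) (e : (ℕ × ℕ) × (ℕ × ℕ)) =>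
        e.1.1 = Nat.pair 1 (Nat.pair (Nat.pair 0 a.1.2) e.2.1) ∧ IotaLE e.2.2 a.2)
      (g := fun _ e => e.1.2)
      (Primrec.list_product.comp hG hG) (.const 1) (.and ?_ ?_) ?_) (.and ?_ ?_) ?_
  · exact Primrec.eq.comp (Primrec.fst.comp (Primrec.fst.comp .snd))
      (Primrec₂.natPair.comp (.const 1) (Primrec₂.natPair.comp (hx.comp .fst)
        (Primrec.fst.comp (Primrec.snd.comp .snd))))
  · exact PrimrecRel.iotaLE.comp (Primrec.snd.comp (Primrec.snd.comp .snd))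
      (Primrec.snd.comp .fst)
  · exact (Primrec.snd.comp (Primrec.fst.comp .snd)).to₂
  · exact Primrec.eq.comp (Primrec.fst.comp .snd)
      (Primrec₂.natPair.comp (.const 4) (hx.comp .fst))
  · exact Primrec.eq.comp (Primrec.snd.comp .snd) (.const 0)
  · exact (Primrec.iotaSub.comp (Primrec.snd.comp .fst)
      (Primrec.maxValue.comp (hG.comp .fst))).to₂

/-- There is a program that computes `extensionValue G x`, uniformly in `G` and `x`. -/
theorem exists_computable_extensionCode :
    ∃ D : List (ℕ × ℕ) × ℕ → Nat.Partrec.Code, Computable D ∧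
      ∀ G x m, extensionValue G x m ∈ (D (G, x)).eval m := by
  -- One program takes graph, variable and argument together; currying (the s-m-n theorem)
  -- specialises it computably to the first two.
  obtain ⟨c, hc⟩ := Nat.Partrec.Code.exists_code.1 primrec_extensionValue.to_comp
  refine ⟨fun a => c.curry (Encodable.encode a),
    (Nat.Partrec.Code.primrec₂_curry.comp (.const c) .encode).to_comp, fun G x m => ?_⟩
  have h : Nat.pair (Encodable.encode (G, x)) m = Encodable.encode ((G, x), m) := rfl
  rw [Nat.Partrec.Code.eval_curry, hc, h]
  simp

/-! ## The main theorem -/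

/-- The valuation depends on `w` alone; every listing of the graph of `w` then computes this same
valuation. -/
theorem exists_valuation_of_realize_phi {κ : ℕ} {ts : List BasicTerm} (hts : ts ≠ [])
    {w : Sample.diagramDomain κ ts → ℕ} (hw : (phi κ ts).Realize w) :
    ∃ θ : ℕ → TimeWarp, ¬ (idLeJoin ts).Holds θ ∧ ∀ G : List (Sample × ℕ), Enumerates G w →
      ∀ x m : ℕ, iota (extensionValue (codeGraph G) x m) = θ x (iota m) := by
  classical
  -- The default `0` outside `Δ` is never read.
  let δ : Sample → ℕ∞ := fun α => if h : α ∈ Sample.diagramDomain κ ts then iota (w ⟨α, h⟩) else 0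
  have hδ : ∀ {α} (h : α ∈ Sample.diagramDomain κ ts), δ α = iota (w ⟨α, h⟩) := fun h => dif_pos h
  have hΔ : Sample.Saturated (Sample.diagramDomain κ ts) := Sample.saturated_saturation _
  obtain ⟨D, hfail⟩ := (Sample.realize_psiSet_iff hΔ fun a => (hδ a.2).symm).1
    (realize_phi_iff.1 hw)
  let _ := Fintype.ofFinite (Sample.diagramDomain κ ts)
  -- The supremum of representatives, so that it agrees with `maxValue` of any listing of the graph.
  let N : ℕ := Finset.univ.sup w
  have hN : ∀ α ∈ Sample.diagramDomain κ ts, δ α ≠ ⊤ → δ α ≤ N := fun α h ht => by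
    rw [hδ h] at ht ⊢
    have hle : w ⟨α, h⟩ ≤ N := Finset.le_sup (Finset.mem_univ _)
    rcases hk : w ⟨α, h⟩ with _ | k
    · exact absurd (by rw [hk]; rfl) ht
    · exact Nat.cast_le.2 (by omega)
  let θ : ℕ → TimeWarp := fun x => Sample.warpExtension hΔ D N x
  have hθ := Sample.extends_eval hΔ D (θ := θ) fun x => Sample.extends_warpExtension hΔ D hN
  refine ⟨θ, (not_holds_idLeJoin_iff θ hts).2 ⟨δ (.tvar κ), fun t ht => ?_⟩, fun G hG x m => ?_⟩
  · have hmem : Sample.app t (.tvar κ) ∈ Sample.diagramDomain κ ts :=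
      Sample.subset_saturation _ ⟨t, ht, rfl⟩
    rw [(hθ t).map_eq hmem]
    exact hfail t ht hmem
  · have hmem : ∀ α k, (α.code, k) ∈ codeGraph G ↔
        ∃ h : α ∈ Sample.diagramDomain κ ts, w ⟨α, h⟩ = k := fun α k => by
      rw [← hG α k]
      refine ⟨fun h => ?_, fun h => List.mem_map.2 ⟨(α, k), h, rfl⟩⟩
      obtain ⟨⟨β, j⟩, hβ, e⟩ := List.mem_map.1 h
      obtain ⟨e1, rfl⟩ := Prod.mk.inj e
      exact Sample.code_injective e1 ▸ hβ
    have hmax : maxValue (codeGraph G) = N := by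
      refine eq_of_forall_ge_iff fun c => ?_
      rw [maxValue_le_iff, Finset.sup_le_iff]
      constructor
      · exact fun h a _ => h _ ((hmem a.1 _).2 ⟨a.2, rfl⟩)
      · intro h e he
        obtain ⟨⟨β, j⟩, hβ, rfl⟩ := List.mem_map.1 he
        obtain ⟨hβ', rfl⟩ := (hG β j).1 hβ
        exact h _ (Finset.mem_univ _)
    -- Equality is checked on upper bounds: each clause about list entries is translated into the
    -- clause about samples with those codes, using that Gödel numbering is injective.
    refine eq_of_forall_ge_iff fun c => ?_
    refine iota_extensionValue_le_iff.trans
      (Iff.trans ?_ (Sample.stepExtension_le_iff _ δ N x).symm)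
    rw [hmax]
    refine and_congr ⟨fun h α hα hle => ?_, fun h a k b j ha hb e hle => ?_⟩ ?_
    · have hα' := hΔ.arg hα
      rw [hδ hα'] at hle
      rw [hδ hα]
      exact h _ _ _ _ ((hmem (.app (.var x) α) _).2 ⟨hα, rfl⟩) ((hmem α _).2 ⟨hα', rfl⟩) rfl hle
    · obtain ⟨⟨β, j⟩, hβ, e'⟩ := List.mem_map.1 hb
      obtain ⟨rfl, rfl⟩ := Prod.mk.inj e'
      obtain ⟨hβ', rfl⟩ := (hG β j).1 hβ
      subst e
      obtain ⟨hα, rfl⟩ := (hmem (.app (.var x) β) k).1 ha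
      rw [← hδ hα]
      rw [← hδ hβ'] at hle
      exact h β hα hle
    · have : (Nat.pair 4 (Nat.pair 0 x), 0) ∈ codeGraph G ↔ _ := hmem (.last (.var x)) 0
      rw [this, forall_exists_index]
      refine forall_congr' fun hl => ?_
      rw [hδ hl, iota_eq_top_iff]

theorem theorem4 :
    (∀ (κ : ℕ) (ts : List BasicTerm), ts ≠ [] →
      (phi κ ts).IsQF ∧
      ((idLeJoin ts).Valid ↔ ¬ ∃ w : Sample.diagramDomain κ ts → ℕ, (phi κ ts).Realize w)) ∧
    ∃ D : List (ℕ × ℕ) × ℕ → Nat.Partrec.Code, Computable D ∧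
      ∀ (κ : ℕ) (ts : List BasicTerm), ts ≠ [] →
        ∀ w : Sample.diagramDomain κ ts → ℕ, (phi κ ts).Realize w →
          ∃ θ : ℕ → TimeWarp, ¬ (idLeJoin ts).Holds θ ∧
            ∀ G : List (Sample × ℕ), Enumerates G w →
              ∀ x : ℕ, Describes (D (codeGraph G, x)) (θ x) := by
  refine ⟨fun κ ts hts => ⟨isQF_phi κ ts, ?_⟩, ?_⟩
  · constructor
    · rintro h ⟨w, hw⟩
      obtain ⟨θ, hθ, -⟩ := exists_valuation_of_realize_phi hts hw
      exact hθ (h θ)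
    · intro h θ
      by_contra hc
      exact h (exists_realize_phi hts hc)
  · obtain ⟨D, hD, hval⟩ := exists_computable_extensionCode
    refine ⟨D, hD, fun κ ts hts w hw => ?_⟩
    obtain ⟨θ, hθ, hG⟩ := exists_valuation_of_realize_phi hts hw
    exact ⟨θ, hθ, fun G h x m => ⟨_, hval _ x m, hG G h x m⟩⟩
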